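/- Let $p\ge 2$ be an integer, $\mathfrak q=e^{i\pi/p}$, and $[n]=\frac{\mathfrak q^n-\mathfrak q^{-n}}{\mathfrak q-\mathfrak q^{-1}}$. Let $U$ be the restricted quantum group of $s\ell(2)$: the Hopf algebra over $\mathbb C$ with generators $E$, $F$, $K^{\pm1}$ and relations $$KEK^{-1}=\mathfrak q^2E,\quad KFK^{-1}=\mathfrak q^{-2}F,\quad [E,F]=\frac{K-K^{-1}}{\mathfrak q-\mathfrak q^{-1}},\quad E^p=F^p=0,\quad K^{2p}=1,$$ with $\Delta(E)=1\otimes E+E\otimes K$, $\Delta(F)=K^{-1}\otimes F+F\otimes 1$, $\Delta(K)=K\otimes K$, $\epsilon(E)=\epsilon(F)=0$, $\epsilon(K)=1$, $S(E)=-EK^{-1}$, $S(F)=-KF$, $S(K)=K^{-1}$. The space of $q$-characters of $U$ is $$\mathsf{Ch}=\{\beta\in U^*\mid \beta(xy)=\beta(S^2(y)x)\ \text{ for all } x,y\in U\},$$ and the balancing element is $\boldsymbol g=K^{p+1}$. For $\varepsilon=\pm1$ and $1\le s\le p-1$, let $\mathsf P^{\varepsilon}_s$ be the $U$-module with basis $\mathsf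 t_n,\mathsf b_n$ ($0\le n\le s-1$) and $\mathsf l_k,\mathsf r_k$ ($0\le k\le p-s-1$) and action $$K\mathsf t_n=\varepsilon\mathfrak q^{s-1-2n}\mathsf t_n,\quad K\mathsf b_n=\varepsilon\mathfrak q^{s-1-2n}\mathsf b_n,\quad K\mathsf l_k=-\varepsilon\mathfrak q^{p-s-1-2k}\mathsf l_k,\quad K\mathsf r_k=-\varepsilon\mathfrak q^{p-s-1-2k}\mathsf r_k,$$ $$E\mathsf t_n=\varepsilon[n][s-n]\mathsf t_{n-1}+\mathsf b_{n-1}\ (n\ge1),\quad E\mathsf t_0=\mathsf l_{p-s-1},\quad E\mathsf b_n=\varepsilon[n][s-n]\mathsf b_{n-1},$$ $$E\mathsf l_k=-\varepsilon[k][p-s-k]\mathsf l_{k-1},\quad E\mathsf r_k=-\varepsilon[k][p-s-k]\mathsf r_{k-1}\ (k\ge1),\quad E\mathsf r_0=\mathsf b_{s-1},$$ $$F\mathsf t_n=\mathsf t_{n+1}\ (n\le s-2),\quad F\mathsf t_{s-1}=\mathsf r_0,\quad F\mathsf b_n=\mathsf b_{n+1},$$ $$F\mathsf l_k=\mathsf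 l_{k+1}\ (k\le p-s-2),\quad F\mathsf l_{p-s-1}=\mathsf b_0,\quad F\mathsf r_k=\mathsf r_{k+1},$$ where $\mathsf b_{-1}=\mathsf l_{-1}=\mathsf b_s=\mathsf r_{p-s}=0$. Let $1\le s\le p-1$ and let $\alpha^+_s,\alpha^-_s,\beta^+_s,\beta^-_s\in\mathbb C$ be arbitrary. Write $\mathsf t^{(+,s)}_n,\mathsf b^{(+,s)}_n$ ($0\le n\le s-1$) for the vectors $\mathsf t_n,\mathsf b_n$ of $\mathsf P^+_s$, and $\mathsf t^{(-,s)}_n,\mathsf b^{(-,s)}_n$ ($0\le n\le p-s-1$) for those of $\mathsf P^-_{p-s}$. Let $\sigma_s$ be the linear endomorphism of $\mathsf P^+_s\oplus\mathsf P^-_{p-s}$ that maps $\mathsf b^{(\pm,s)}_n\mapsto\alpha^\pm_s\mathsf t^{(\pm,s)}_n+\beta^\pm_s\mathsf b^{(\pm,s)}_n$ and all other basis vectors to $0$. Then the functional $$\gamma(s):U\to\mathbb C,\qquad x\mapsto\mathrm{Tr}_{\mathsf P^+_s\oplus\mathsf P^-_{p-s}}(\boldsymbol g^{-1}x\,\sigma_s),$$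 belongs to $\mathsf{Ch}$ if and only if $\alpha^+_s=\alpha^-_s$. -/

import Mathlib

open scoped TensorProduct

noncomputable section

/-! ### q-characters of a Hopf algebra -/

/-- The space of q-characters of a Hopf algebra `A` over `R`: the functionals `β` on `A` with
`β (x y) = β (S²(y) x)` for all `x`, `y`, where `S` is the antipode. -/
def qCharacters (R A : Type*) [CommRing R] [Ring A] [HopfAlgebra R A] :
    Submodule R (Module.Dual R A) where
  carrier := {β | ∀ x y : A,
    β (x * y) = β (HopfAlgebra.antipode R (HopfAlgebra.antipode R y) * x)}
  add_mem' := by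
    intro a b ha hb x y
    simp only [LinearMap.add_apply, ha x y, hb x y]
  zero_mem' := by
    intro x y
    simp only [LinearMap.zero_apply]
  smul_mem' := by
    intro c a ha x y
    simp only [LinearMap.smul_apply, ha x y]

namespace UqSL2

/-! ### The q-binomial theorem at a root of unity (used for the coproduct) -/

section QBinomial

/-- Gaussian binomial coefficients, by the Pascal recursion. -/
def qBinom (w : ℂ) : ℕ → ℕ → ℂ
  | _, 0 => 1
  | 0, _ + 1 => 0
  | n + 1, k + 1 => qBinom w n k + w ^ (k + 1) * qBinom w n (k + 1)

/-- The number `1 + w + ... + w ^ (n - 1)`. -/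
def geomNum (w : ℂ) (n : ℕ) : ℂ := ∑ i ∈ Finset.range n, w ^ i

/-- The factorial built from `geomNum`. -/
def geomFact (w : ℂ) (n : ℕ) : ℂ := ∏ i ∈ Finset.range n, geomNum w (i + 1)

theorem qBinom_eq_zero (w : ℂ) : ∀ (n k : ℕ), n < k → qBinom w n k = 0
  | _, 0, h => by omega
  | 0, _ + 1, _ => by simp [qBinom]
  | n + 1, k + 1, h => by
    rw [qBinom, qBinom_eq_zero w n k (by omega), qBinom_eq_zero w n (k + 1) (by omega)]
    simp

theorem qBinom_self (w : ℂ) : ∀ n : ℕ, qBinom w n n = 1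
  | 0 => by simp [qBinom]
  | n + 1 => by
    rw [qBinom, qBinom_self w n, qBinom_eq_zero w n (n + 1) (by omega)]
    simp

theorem geomNum_add (w : ℂ) (a b : ℕ) :
    geomNum w (a + b) = geomNum w a + w ^ a * geomNum w b := by
  simp [geomNum, Finset.sum_range_add, pow_add, Finset.mul_sum]

theorem geomFact_succ (w : ℂ) (n : ℕ) :
    geomFact w (n + 1) = geomFact w n * geomNum w (n + 1) := by
  simp [geomFact, Finset.prod_range_succ]

theorem qBinom_mul_fact (w : ℂ) : ∀ i j : ℕ,
    qBinom w (i + j) i * geomFact w i * geomFact w j = geomFact w (i + j)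
  | 0, j => by simp [qBinom, geomFact]
  | i + 1, 0 => by simp [qBinom_self, geomFact]
  | i + 1, j + 1 => by
    have h1 := qBinom_mul_fact w i (j + 1)
    have h2 := qBinom_mul_fact w (i + 1) j
    have e1 : i + 1 + (j + 1) = (i + j + 1) + 1 := by ring
    have e2 : i + (j + 1) = i + j + 1 := by ring
    have e3 : i + 1 + j = i + j + 1 := by ring
    rw [e2] at h1
    rw [e3] at h2
    have h3 : geomNum w (i + j + 1 + 1) = geomNum w (i + 1) + w ^ (i + 1) * geomNum w (j + 1) := by
      rw [← geomNum_add]; congr 1; ring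
    rw [e1, qBinom, geomFact_succ w (i + j + 1), h3]
    rw [geomFact_succ w j] at h1 ⊢
    rw [geomFact_succ w i] at h2 ⊢
    linear_combination (geomNum w (i + 1)) * h1 + w ^ (i + 1) * geomNum w (j + 1) * h2

theorem geomNum_ne_zero {w : ℂ} {p : ℕ} (hw : IsPrimitiveRoot w p) {n : ℕ} (h0 : 0 < n)
    (hn : n < p) : geomNum w n ≠ 0 := by
  intro h
  have h1 := geom_sum_mul w n
  rw [show ∑ i ∈ Finset.range n, w ^ i = 0 from h, zero_mul] at h1
  exact hw.pow_ne_one_of_pos_of_lt h0.ne' hn (sub_eq_zero.mp h1.symm)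

theorem geomFact_ne_zero {w : ℂ} {p : ℕ} (hw : IsPrimitiveRoot w p) {n : ℕ}
    (hn : n < p) : geomFact w n ≠ 0 := by
  refine Finset.prod_ne_zero_iff.mpr fun i hi => geomNum_ne_zero hw (by omega) ?_
  have := Finset.mem_range.mp hi
  omega

theorem qBinom_root {w : ℂ} {p : ℕ} (hw : IsPrimitiveRoot w p) {k : ℕ} (h0 : 0 < k)
    (hk : k < p) : qBinom w p k = 0 := by
  have h := qBinom_mul_fact w k (p - k)
  rw [Nat.add_sub_of_le hk.le] at h
  have hz : geomFact w p = 0 := by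
    refine Finset.prod_eq_zero (i := p - 1) (Finset.mem_range.mpr (by omega)) ?_
    rw [Nat.sub_add_cancel (by omega)]
    exact hw.geom_sum_eq_zero (by omega)
  rw [hz] at h
  have h1 := geomFact_ne_zero hw hk
  have h2 := geomFact_ne_zero hw (show p - k < p by omega)
  simpa [h1, h2] using h

variable {B : Type*} [Ring B] [Algebra ℂ B]

theorem mul_pow_of_qcomm {a b : B} {w : ℂ} (h : b * a = w • (a * b)) (n : ℕ) :
    b * a ^ n = w ^ n • (a ^ n * b) := by
  induction n with
  | zero => simp
  | succ n ih =>
    rw [pow_succ, ← mul_assoc, ih, smul_mul_assoc, mul_assoc, h, mul_smul_comm, smul_smul,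
      ← mul_assoc, pow_succ]

theorem add_pow_of_qcomm {a b : B} {w : ℂ} (h : b * a = w • (a * b)) (n : ℕ) :
    (a + b) ^ n = ∑ k ∈ Finset.range (n + 1), qBinom w n k • (a ^ k * b ^ (n - k)) := by
  induction n with
  | zero => simp [qBinom]
  | succ n ih =>
    rw [pow_succ', ih, Finset.sum_range_succ' _ (n + 1), add_mul, Finset.mul_sum, Finset.mul_sum]
    have e1 : ∑ k ∈ Finset.range (n + 1), b * (qBinom w n k • (a ^ k * b ^ (n - k)))
        = ∑ k ∈ Finset.range (n + 1 + 1),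
          (w ^ k * qBinom w n k) • (a ^ k * b ^ (n + 1 - k)) := by
      rw [Finset.sum_range_succ _ (n + 1), qBinom_eq_zero w n (n + 1) (by omega)]
      simp only [mul_zero, zero_smul, add_zero]
      refine Finset.sum_congr rfl fun k hk => ?_
      have hk' := Finset.mem_range.mp hk
      rw [mul_smul_comm, ← mul_assoc, mul_pow_of_qcomm h, smul_mul_assoc, smul_smul, mul_assoc,
        ← pow_succ', show n + 1 - k = n - k + 1 by omega, mul_comm]
    rw [e1, Finset.sum_range_succ' _ (n + 1), ← add_assoc, ← Finset.sum_add_distrib]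
    congr 1
    · refine Finset.sum_congr rfl fun k hk => ?_
      rw [qBinom, add_smul, mul_smul_comm, ← mul_assoc, ← pow_succ',
        show n + 1 - (k + 1) = n - k by omega]
    · cases n <;> simp [qBinom]

theorem add_pow_eq_zero {a b : B} {w : ℂ} {p : ℕ} (hw : IsPrimitiveRoot w p)
    (h : b * a = w • (a * b)) (ha : a ^ p = 0) (hb : b ^ p = 0) : (a + b) ^ p = 0 := by
  rw [add_pow_of_qcomm h]
  refine Finset.sum_eq_zero fun k hk => ?_
  have hk' := Finset.mem_range.mp hk
  rcases Nat.eq_zero_or_pos k with rfl | h0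
  · simp [hb]
  · rcases Nat.lt_or_ge k p with h1 | h1
    · rw [qBinom_root hw h0 h1, zero_smul]
    · rw [show k = p by omega, ha, zero_mul, smul_zero]

theorem qcomm_mul_pow {x y : B} {w : ℂ} (h : y * x = w • (x * y)) (n : ℕ) :
    ∃ c : ℂ, (x * y) ^ n = c • (x ^ n * y ^ n) := by
  induction n with
  | zero => exact ⟨1, by simp⟩
  | succ n ih =>
    obtain ⟨c, hc⟩ := ih
    refine ⟨w ^ n * c, ?_⟩
    rw [pow_succ', hc, mul_smul_comm, mul_assoc, ← mul_assoc y, mul_pow_of_qcomm h,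
      smul_mul_assoc, mul_smul_comm, smul_smul, mul_comm c, mul_assoc (x ^ n), ← mul_assoc x,
      ← pow_succ', ← pow_succ']

end QBinomial

/-! ### The parameter and the q-integers -/

/-- The root of unity `q = exp (i π / p)`. -/
def q (p : ℕ) : ℂ := Complex.exp (Complex.I * Real.pi / p)

/-- The q-integer `[n] = (q^n - q^(-n)) / (q - q^(-1))`. -/
def qInt (p : ℕ) (n : ℤ) : ℂ := (q p ^ n - q p ^ (-n)) / (q p - (q p)⁻¹)

theorem q_ne_zero (p : ℕ) : q p ≠ 0 := Complex.exp_ne_zero _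

theorem q_pow_p {p : ℕ} (hp : 0 < p) : q p ^ p = -1 := by
  rw [q, ← Complex.exp_nat_mul, mul_div_cancel₀ _ (by exact_mod_cast hp.ne'), mul_comm,
    Complex.exp_pi_mul_I]

theorem q_sq_primitive {p : ℕ} (hp : 0 < p) : IsPrimitiveRoot (q p ^ 2) p := by
  have h := Complex.isPrimitiveRoot_exp p hp.ne'
  rw [q, ← Complex.exp_nat_mul]
  convert h using 2
  push_cast
  ring

theorem q_sub_inv_ne_zero {p : ℕ} (hp : 2 ≤ p) : q p - (q p)⁻¹ ≠ 0 := by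
  intro h
  have h1 : q p ^ 2 = 1 := by
    have h2 := sub_eq_zero.mp h
    rw [sq]
    nth_rewrite 2 [h2]
    exact mul_inv_cancel₀ (q_ne_zero p)
  exact (q_sq_primitive (p := p) (by omega)).ne_one (by omega) h1

/-! ### The algebra -/

/-- Generators `E`, `F`, `K` and the formal inverse of `K`. -/
inductive Gen : Type
  | E | F | K | Kinv

/-- The generators inside the free algebra. -/
abbrev gen (x : Gen) : FreeAlgebra ℂ Gen := FreeAlgebra.ι ℂ x

/-- The defining relations of the restricted quantum group. -/
inductive Rel (p : ℕ) : FreeAlgebra ℂ Gen → FreeAlgebra ℂ Gen → Prop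
  | K_mul_Kinv : Rel p (gen .K * gen .Kinv) 1
  | Kinv_mul_K : Rel p (gen .Kinv * gen .K) 1
  | K_E : Rel p (gen .K * gen .E * gen .Kinv) ((q p ^ (2 : ℤ)) • gen .E)
  | K_F : Rel p (gen .K * gen .F * gen .Kinv) ((q p ^ (-2 : ℤ)) • gen .F)
  | E_F : Rel p (gen .E * gen .F - gen .F * gen .E)
      ((q p - (q p)⁻¹)⁻¹ • (gen .K - gen .Kinv))
  | E_pow : Rel p (gen .E ^ p) 0
  | F_pow : Rel p (gen .F ^ p) 0
  | K_pow : Rel p (gen .K ^ (2 * p)) 1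

end UqSL2

/-- The restricted quantum group of `sl(2)` at `q = exp (i π / p)`. -/
def RestrictedUqSL2 (p : ℕ) : Type := RingQuot (UqSL2.Rel p)

namespace UqSL2

instance (p : ℕ) : Ring (RestrictedUqSL2 p) := inferInstanceAs (Ring (RingQuot (Rel p)))

instance (p : ℕ) : Algebra ℂ (RestrictedUqSL2 p) :=
  inferInstanceAs (Algebra ℂ (RingQuot (Rel p)))

/-- The quotient map from the free algebra. -/
def mk (p : ℕ) : FreeAlgebra ℂ Gen →ₐ[ℂ] RestrictedUqSL2 p := RingQuot.mkAlgHom ℂ (Rel p)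

theorem mk_rel {p : ℕ} {x y : FreeAlgebra ℂ Gen} (h : Rel p x y) : mk p x = mk p y :=
  RingQuot.mkAlgHom_rel ℂ h

/-- The generator `E`. -/
def E (p : ℕ) : RestrictedUqSL2 p := mk p (gen .E)
/-- The generator `F`. -/
def F (p : ℕ) : RestrictedUqSL2 p := mk p (gen .F)
/-- The generator `K`, as a unit. -/
def Ku (p : ℕ) : (RestrictedUqSL2 p)ˣ where
  val := mk p (gen .K)
  inv := mk p (gen .Kinv)
  val_inv := by
    rw [← map_mul, ← map_one (mk p)]
    exact mk_rel Rel.K_mul_Kinv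
  inv_val := by
    rw [← map_mul, ← map_one (mk p)]
    exact mk_rel Rel.Kinv_mul_K
/-- The generator `K`. -/
def K (p : ℕ) : RestrictedUqSL2 p := (Ku p : RestrictedUqSL2 p)
/-- The element `K⁻¹`. -/
def Kinv (p : ℕ) : RestrictedUqSL2 p := ((Ku p)⁻¹ : (RestrictedUqSL2 p)ˣ)

/-- The relations, for elements `e f k ki` of an algebra. -/
structure Satisfies (p : ℕ) {B : Type*} [Ring B] [Algebra ℂ B] (e f k ki : B) : Prop where
  k_ki : k * ki = 1
  ki_k : ki * k = 1
  k_e : k * e * ki = (q p ^ (2 : ℤ)) • e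
  k_f : k * f * ki = (q p ^ (-2 : ℤ)) • f
  e_f : e * f - f * e = (q p - (q p)⁻¹)⁻¹ • (k - ki)
  e_pow : e ^ p = 0
  f_pow : f ^ p = 0
  k_pow : k ^ (2 * p) = 1

theorem satisfies_gen (p : ℕ) : Satisfies p (E p) (F p) (K p) (Kinv p) where
  k_ki := (Ku p).mul_inv
  ki_k := (Ku p).inv_mul
  k_e := by
    have := mk_rel (Rel.K_E (p := p))
    simp only [map_mul, map_smul] at this
    exact this
  k_f := by
    have := mk_rel (Rel.K_F (p := p))
    simp only [map_mul, map_smul] at this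
    exact this
  e_f := by
    have := mk_rel (Rel.E_F (p := p))
    simp only [map_mul, map_smul, map_sub] at this
    exact this
  e_pow := by
    have := mk_rel (Rel.E_pow (p := p))
    simp only [map_pow, map_zero] at this
    exact this
  f_pow := by
    have := mk_rel (Rel.F_pow (p := p))
    simp only [map_pow, map_zero] at this
    exact this
  k_pow := by
    have := mk_rel (Rel.K_pow (p := p))
    simp only [map_pow, map_one] at this
    exact this

/-- The images of the generators. -/
def genMap {B : Type*} (e f k ki : B) : Gen → B
  | .E => e
  | .F => f
  | .K => k
  | .Kinv => ki

/-- The universal property: an algebra map is given by the images of the generators. -/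
def lift {p : ℕ} {B : Type*} [Ring B] [Algebra ℂ B] {e f k ki : B}
    (h : Satisfies p e f k ki) : RestrictedUqSL2 p →ₐ[ℂ] B :=
  RingQuot.liftAlgHom ℂ (s := Rel p) ⟨FreeAlgebra.lift ℂ (genMap e f k ki), by
    intro x y hxy
    cases hxy
    · simpa [genMap] using h.k_ki
    · simpa [genMap] using h.ki_k
    · simpa [genMap] using h.k_e
    · simpa [genMap] using h.k_f
    · simpa [genMap] using h.e_f
    · simpa [genMap] using h.e_pow
    · simpa [genMap] using h.f_pow
    · simpa [genMap] using h.k_pow⟩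

section LiftLemmas

variable {p : ℕ} {B : Type*} [Ring B] [Algebra ℂ B] {e f k ki : B} (h : Satisfies p e f k ki)

theorem lift_mk (x : FreeAlgebra ℂ Gen) :
    lift h (mk p x) = FreeAlgebra.lift ℂ (genMap e f k ki) x :=
  RingQuot.liftAlgHom_mkAlgHom_apply ℂ _ _ _

@[simp] theorem lift_E : lift h (E p) = e := by simp [E, lift_mk, genMap]
@[simp] theorem lift_F : lift h (F p) = f := by simp [F, lift_mk, genMap]
@[simp] theorem lift_K : lift h (K p) = k := by simp [K, Ku, lift_mk, genMap]
@[simp] theorem lift_Kinv : lift h (Kinv p) = ki := by simp [Kinv, Ku, lift_mk, genMap]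

end LiftLemmas

theorem induct {p : ℕ} {P : RestrictedUqSL2 p → Prop}
    (hc : ∀ c : ℂ, P (algebraMap ℂ _ c)) (hE : P (E p)) (hF : P (F p)) (hK : P (K p))
    (hK' : P (Kinv p)) (hmul : ∀ a b, P a → P b → P (a * b))
    (hadd : ∀ a b, P a → P b → P (a + b)) (x : RestrictedUqSL2 p) : P x := by
  obtain ⟨x, rfl⟩ := RingQuot.mkAlgHom_surjective ℂ (Rel p) x
  change P (mk p x)
  induction x using FreeAlgebra.induction with
  | grade0 r => rw [AlgHom.commutes]; exact hc r
  | grade1 x =>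
    cases x
    · exact hE
    · exact hF
    · exact hK
    · exact hK'
  | mul a b ha hb => rw [map_mul]; exact hmul _ _ ha hb
  | add a b ha hb => rw [map_add]; exact hadd _ _ ha hb

theorem algHom_ext {p : ℕ} {B : Type*} [Ring B] [Algebra ℂ B]
    {φ ψ : RestrictedUqSL2 p →ₐ[ℂ] B} (hE : φ (E p) = ψ (E p)) (hF : φ (F p) = ψ (F p))
    (hK : φ (K p) = ψ (K p)) (hK' : φ (Kinv p) = ψ (Kinv p)) : φ = ψ := by
  ext x
  induction x using induct with
  | hc c => simp
  | hE => exact hE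
  | hF => exact hF
  | hK => exact hK
  | hK' => exact hK'
  | hmul a b ha hb => rw [map_mul, map_mul, ha, hb]
  | hadd a b ha hb => rw [map_add, map_add, ha, hb]

/-! ### Consequences of the relations -/

section Consequences

variable {p : ℕ} {B : Type*} [Ring B] [Algebra ℂ B] {e f k ki : B}

theorem Satisfies.ke (h : Satisfies p e f k ki) : k * e = (q p ^ 2) • (e * k) := by
  have := congrArg (· * k) h.k_e
  simpa [mul_assoc, h.ki_k] using this

theorem Satisfies.kf (h : Satisfies p e f k ki) : f * k = (q p ^ 2) • (k * f) := by
  have := congrArg (· * k) h.k_f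
  have h2 : k * f = (q p ^ (-2 : ℤ)) • (f * k) := by simpa [mul_assoc, h.ki_k] using this
  rw [h2, smul_smul, zpow_neg, ← zpow_natCast, Nat.cast_ofNat,
    mul_inv_cancel₀ (zpow_ne_zero _ (q_ne_zero p)), one_smul]

theorem Satisfies.e_ki (h : Satisfies p e f k ki) : e * ki = (q p ^ 2) • (ki * e) := by
  have h1 := congrArg (fun x => ki * x * ki) h.ke
  simp only [mul_smul_comm, smul_mul_assoc] at h1
  rw [← mul_assoc, h.ki_k, one_mul, mul_assoc, mul_assoc, h.k_ki, mul_one] at h1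
  exact h1

theorem Satisfies.ki_f (h : Satisfies p e f k ki) : ki * f = (q p ^ 2) • (f * ki) := by
  have h1 := congrArg (fun x => ki * x * ki) h.kf
  simp only [mul_smul_comm, smul_mul_assoc] at h1
  rw [← mul_assoc ki k f, h.ki_k, one_mul, mul_assoc, mul_assoc, h.k_ki, mul_one] at h1
  exact h1

theorem Satisfies.ki_pow (h : Satisfies p e f k ki) : ki ^ (2 * p) = 1 := by
  have h1 : Commute k ki := by rw [Commute, SemiconjBy, h.k_ki, h.ki_k]
  have h2 := h1.mul_pow (2 * p)
  rw [h.k_ki, one_pow, h.k_pow, one_mul] at h2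
  exact h2.symm

end Consequences

/-! ### The Hopf algebra structure -/

section Hopf

open TensorProduct

theorem satisfies_comul (p : ℕ) [NeZero p] :
    Satisfies p (B := RestrictedUqSL2 p ⊗[ℂ] RestrictedUqSL2 p)
      (1 ⊗ₜ E p + E p ⊗ₜ K p) (Kinv p ⊗ₜ F p + F p ⊗ₜ 1) (K p ⊗ₜ K p) (Kinv p ⊗ₜ Kinv p) := by
  have h := satisfies_gen p
  have hp : 0 < p := Nat.pos_of_ne_zero (NeZero.ne p)
  constructor
  · simp [h.k_ki, Algebra.TensorProduct.one_def]
  · simp [h.ki_k, Algebra.TensorProduct.one_def]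
  · simp only [mul_add, add_mul, Algebra.TensorProduct.tmul_mul_tmul, mul_one, h.k_ki, h.k_e,
      smul_add, TensorProduct.smul_tmul', TensorProduct.tmul_smul]
    rw [mul_assoc (K p) (K p), h.k_ki, mul_one]
  · simp only [mul_add, add_mul, Algebra.TensorProduct.tmul_mul_tmul, mul_one, h.k_ki, h.k_f,
      smul_add, TensorProduct.smul_tmul', TensorProduct.tmul_smul, one_mul]
  · simp only [mul_add, add_mul, Algebra.TensorProduct.tmul_mul_tmul, mul_one, one_mul,
      h.e_ki, h.kf, TensorProduct.smul_tmul', TensorProduct.tmul_smul]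
    have h1 : E p * F p = F p * E p + (q p - (q p)⁻¹)⁻¹ • (K p - Kinv p) := by
      rw [← h.e_f]; abel
    rw [h1]
    simp only [TensorProduct.tmul_add, TensorProduct.add_tmul, TensorProduct.smul_tmul',
      TensorProduct.tmul_smul, TensorProduct.tmul_sub, TensorProduct.sub_tmul, smul_sub]
    abel
  · refine add_pow_eq_zero (q_sq_primitive hp) ?_ ?_ ?_
    · simp only [Algebra.TensorProduct.tmul_mul_tmul, mul_one, one_mul, h.ke,
        TensorProduct.tmul_smul]
    · rw [Algebra.TensorProduct.tmul_pow, h.e_pow, TensorProduct.tmul_zero]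
    · rw [Algebra.TensorProduct.tmul_pow, h.e_pow, TensorProduct.zero_tmul]
  · rw [add_comm]
    refine add_pow_eq_zero (q_sq_primitive hp) ?_ ?_ ?_
    · simp only [Algebra.TensorProduct.tmul_mul_tmul, mul_one, one_mul, h.ki_f,
        TensorProduct.smul_tmul']
    · rw [Algebra.TensorProduct.tmul_pow, h.f_pow, TensorProduct.zero_tmul]
    · rw [Algebra.TensorProduct.tmul_pow, h.f_pow, TensorProduct.tmul_zero]
  · rw [Algebra.TensorProduct.tmul_pow, h.k_pow, Algebra.TensorProduct.one_def]

theorem satisfies_counit (p : ℕ) [NeZero p] : Satisfies p (0 : ℂ) 0 1 1 := by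
  constructor <;> simp [NeZero.ne p]

theorem satisfies_antipode (p : ℕ) [NeZero p] :
    Satisfies p (B := (RestrictedUqSL2 p)ᵐᵒᵖ)
      (MulOpposite.op (-(E p * Kinv p))) (MulOpposite.op (-(K p * F p)))
      (MulOpposite.op (Kinv p)) (MulOpposite.op (K p)) := by
  have h := satisfies_gen p
  constructor <;> apply MulOpposite.unop_injective
  · simpa using h.k_ki
  · simpa using h.ki_k
  · simp only [MulOpposite.unop_mul, MulOpposite.unop_op, MulOpposite.unop_smul]
    rw [neg_mul, mul_neg, ← mul_assoc, ← mul_assoc, h.k_e, smul_mul_assoc, smul_neg]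
  · simp only [MulOpposite.unop_mul, MulOpposite.unop_op, MulOpposite.unop_smul]
    rw [neg_mul, mul_neg, mul_assoc, ← mul_assoc (K p) (F p), h.k_f, mul_smul_comm, smul_neg]
  · simp only [MulOpposite.unop_mul, MulOpposite.unop_op, MulOpposite.unop_smul,
      MulOpposite.unop_sub, neg_mul_neg]
    have h1 : K p * F p * (E p * Kinv p) = F p * E p := by
      calc K p * F p * (E p * Kinv p)
          = (K p * F p * Kinv p) * (K p * E p * Kinv p) := by
            simp only [mul_assoc]
            rw [← mul_assoc (Kinv p) (K p), h.ki_k, one_mul]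
        _ = F p * E p := by
            rw [h.k_f, h.k_e, smul_mul_smul_comm, ← zpow_add₀ (q_ne_zero p)]
            simp
    have h2 : E p * Kinv p * (K p * F p) = E p * F p := by
      rw [mul_assoc, ← mul_assoc (Kinv p), h.ki_k, one_mul]
    rw [h1, h2, ← neg_sub, h.e_f, ← smul_neg, neg_sub]
  · simp only [MulOpposite.unop_pow, MulOpposite.unop_op, MulOpposite.unop_zero]
    rw [neg_pow]
    have h1 : Kinv p * E p = (q p ^ 2)⁻¹ • (E p * Kinv p) := by
      rw [h.e_ki, smul_smul, inv_mul_cancel₀ (pow_ne_zero _ (q_ne_zero p)), one_smul]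
    obtain ⟨c, hc⟩ := qcomm_mul_pow h1 p
    rw [hc, h.e_pow]
    simp
  · simp only [MulOpposite.unop_pow, MulOpposite.unop_op, MulOpposite.unop_zero]
    rw [neg_pow]
    obtain ⟨c, hc⟩ := qcomm_mul_pow h.kf p
    rw [hc, h.f_pow]
    simp
  · simpa using h.ki_pow

/-- The coproduct. -/
def comulHom (p : ℕ) [NeZero p] :
    RestrictedUqSL2 p →ₐ[ℂ] RestrictedUqSL2 p ⊗[ℂ] RestrictedUqSL2 p :=
  lift (satisfies_comul p)

/-- The counit. -/
def counitHom (p : ℕ) [NeZero p] : RestrictedUqSL2 p →ₐ[ℂ] ℂ := lift (satisfies_counit p)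

/-- The antipode, as an algebra map to the opposite algebra. -/
def antipodeHom (p : ℕ) [NeZero p] : RestrictedUqSL2 p →ₐ[ℂ] (RestrictedUqSL2 p)ᵐᵒᵖ :=
  lift (satisfies_antipode p)

/-- The antipode, as a linear map. -/
def antipodeLin (p : ℕ) [NeZero p] : RestrictedUqSL2 p →ₗ[ℂ] RestrictedUqSL2 p :=
  (MulOpposite.opLinearEquiv ℂ).symm.toLinearMap ∘ₗ (antipodeHom p).toLinearMap

section Values

variable (p : ℕ) [NeZero p]

@[simp] theorem comulHom_E : comulHom p (E p) = 1 ⊗ₜ E p + E p ⊗ₜ K p := lift_E _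
@[simp] theorem comulHom_F : comulHom p (F p) = Kinv p ⊗ₜ F p + F p ⊗ₜ 1 := lift_F _
@[simp] theorem comulHom_K : comulHom p (K p) = K p ⊗ₜ K p := lift_K _
@[simp] theorem comulHom_Kinv : comulHom p (Kinv p) = Kinv p ⊗ₜ Kinv p := lift_Kinv _
@[simp] theorem counitHom_E : counitHom p (E p) = 0 := lift_E _
@[simp] theorem counitHom_F : counitHom p (F p) = 0 := lift_F _
@[simp] theorem counitHom_K : counitHom p (K p) = 1 := lift_K _
@[simp] theorem counitHom_Kinv : counitHom p (Kinv p) = 1 := lift_Kinv _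
@[simp] theorem antipodeLin_E : antipodeLin p (E p) = -(E p * Kinv p) := by
  simp [antipodeLin, antipodeHom]
@[simp] theorem antipodeLin_F : antipodeLin p (F p) = -(K p * F p) := by
  simp [antipodeLin, antipodeHom]
@[simp] theorem antipodeLin_K : antipodeLin p (K p) = Kinv p := by
  simp [antipodeLin, antipodeHom]
@[simp] theorem antipodeLin_Kinv : antipodeLin p (Kinv p) = K p := by
  simp [antipodeLin, antipodeHom]
@[simp] theorem antipodeLin_one : antipodeLin p 1 = 1 := by
  simp [antipodeLin]
theorem antipodeLin_algebraMap (c : ℂ) :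
    antipodeLin p (algebraMap ℂ _ c) = algebraMap ℂ _ c := by
  rw [Algebra.algebraMap_eq_smul_one, map_smul, antipodeLin_one]
theorem antipodeLin_mul (a b : RestrictedUqSL2 p) :
    antipodeLin p (a * b) = antipodeLin p b * antipodeLin p a := by
  simp [antipodeLin]

/-- The map `a ⊗ b ↦ S(a) b`. -/
def antiL : RestrictedUqSL2 p ⊗[ℂ] RestrictedUqSL2 p →ₗ[ℂ] RestrictedUqSL2 p :=
  LinearMap.mul' ℂ _ ∘ₗ (antipodeLin p).rTensor _

/-- The map `a ⊗ b ↦ a S(b)`. -/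
def antiR : RestrictedUqSL2 p ⊗[ℂ] RestrictedUqSL2 p →ₗ[ℂ] RestrictedUqSL2 p :=
  LinearMap.mul' ℂ _ ∘ₗ (antipodeLin p).lTensor _

@[simp] theorem antiL_tmul (a b : RestrictedUqSL2 p) :
    antiL p (a ⊗ₜ b) = antipodeLin p a * b := by simp [antiL]

@[simp] theorem antiR_tmul (a b : RestrictedUqSL2 p) :
    antiR p (a ⊗ₜ b) = a * antipodeLin p b := by simp [antiR]

theorem antiL_mul_tmul (z : RestrictedUqSL2 p ⊗[ℂ] RestrictedUqSL2 p) (a b : RestrictedUqSL2 p) :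
    antiL p (z * a ⊗ₜ b) = antipodeLin p a * antiL p z * b := by
  induction z with
  | zero => simp
  | tmul c d => simp [antipodeLin_mul, mul_assoc]
  | add x y hx hy => simp [add_mul, mul_add, hx, hy]

theorem antiR_tmul_mul (z : RestrictedUqSL2 p ⊗[ℂ] RestrictedUqSL2 p) (a b : RestrictedUqSL2 p) :
    antiR p (a ⊗ₜ b * z) = a * antiR p z * antipodeLin p b := by
  induction z with
  | zero => simp
  | tmul c d => simp [antipodeLin_mul, mul_assoc]
  | add x y hx hy => simp [add_mul, mul_add, hx, hy]

theorem antiL_mul {z : RestrictedUqSL2 p ⊗[ℂ] RestrictedUqSL2 p} {c : ℂ}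
    (hz : antiL p z = algebraMap ℂ _ c) (w : RestrictedUqSL2 p ⊗[ℂ] RestrictedUqSL2 p) :
    antiL p (z * w) = c • antiL p w := by
  induction w with
  | zero => simp
  | tmul a b =>
    rw [antiL_mul_tmul, hz, antiL_tmul, Algebra.algebraMap_eq_smul_one, mul_smul_comm,
      smul_mul_assoc, mul_one]
  | add x y hx hy => simp [mul_add, hx, hy]

theorem antiR_mul {z : RestrictedUqSL2 p ⊗[ℂ] RestrictedUqSL2 p} {c : ℂ}
    (hz : antiR p z = algebraMap ℂ _ c) (w : RestrictedUqSL2 p ⊗[ℂ] RestrictedUqSL2 p) :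
    antiR p (w * z) = c • antiR p w := by
  induction w with
  | zero => simp
  | tmul a b =>
    rw [antiR_tmul_mul, hz, antiR_tmul, Algebra.algebraMap_eq_smul_one, mul_smul_comm,
      smul_mul_assoc, mul_one]
  | add x y hx hy => simp [add_mul, hx, hy]

theorem antiL_comul (x : RestrictedUqSL2 p) :
    antiL p (comulHom p x) = algebraMap ℂ _ (counitHom p x) := by
  have h := satisfies_gen p
  induction x using induct with
  | hc c =>
    rw [AlgHom.commutes, AlgHom.commutes, Algebra.algebraMap_eq_smul_one, map_smul,
      Algebra.TensorProduct.one_def, antiL_tmul, antipodeLin_one, mul_one,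
      Algebra.algebraMap_eq_smul_one]
    rfl
  | hE => simp [mul_assoc, h.ki_k]
  | hF => simp
  | hK => simp [h.ki_k]
  | hK' => simp [h.k_ki]
  | hmul a b ha hb =>
    rw [map_mul, antiL_mul p ha, hb, map_mul, map_mul, Algebra.smul_def]
  | hadd a b ha hb => simp [ha, hb]

theorem antiR_comul (x : RestrictedUqSL2 p) :
    antiR p (comulHom p x) = algebraMap ℂ _ (counitHom p x) := by
  have h := satisfies_gen p
  induction x using induct with
  | hc c =>
    rw [AlgHom.commutes, AlgHom.commutes, Algebra.algebraMap_eq_smul_one, map_smul,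
      Algebra.TensorProduct.one_def, antiR_tmul, antipodeLin_one, mul_one,
      Algebra.algebraMap_eq_smul_one]
    rfl
  | hE => simp
  | hF => simp [← mul_assoc, h.ki_k]
  | hK => simp [h.k_ki]
  | hK' => simp [h.ki_k]
  | hmul a b ha hb =>
    rw [map_mul, antiR_mul p hb, ha, Algebra.smul_def, ← map_mul, map_mul (counitHom p), mul_comm]
  | hadd a b ha hb => simp [ha, hb]

end Values

instance (p : ℕ) [NeZero p] : Bialgebra ℂ (RestrictedUqSL2 p) :=
  Bialgebra.ofAlgHom (comulHom p) (counitHom p)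
    (by
      apply algHom_ext
      · simp [TensorProduct.add_tmul, TensorProduct.tmul_add, Algebra.TensorProduct.one_def,
          add_assoc]
      · simp [TensorProduct.add_tmul, TensorProduct.tmul_add, Algebra.TensorProduct.one_def,
          add_assoc]
      · simp
      · simp)
    (by apply algHom_ext <;> simp)
    (by apply algHom_ext <;> simp)

/-- The Hopf algebra structure:
`Δ E = 1 ⊗ E + E ⊗ K`, `Δ F = K⁻¹ ⊗ F + F ⊗ 1`, `Δ K = K ⊗ K`,
`ε E = ε F = 0`, `ε K = 1`, `S E = - E K⁻¹`, `S F = - K F`, `S K = K⁻¹`. -/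
instance (p : ℕ) [NeZero p] : HopfAlgebra ℂ (RestrictedUqSL2 p) where
  antipode := antipodeLin p
  mul_antipode_rTensor_comul := LinearMap.ext (antiL_comul p)
  mul_antipode_lTensor_comul := LinearMap.ext (antiR_comul p)

end Hopf

/-! ### The projective modules -/

/-- The basis of the projective module `P^±_s`: top vectors `t n` and bottom vectors `b n` with
`0 ≤ n ≤ s - 1`, left vectors `l k` and right vectors `r k` with `0 ≤ k ≤ p - s - 1`. -/
inductive ProjBasis (p s : ℕ) : Type
  | t (n : Fin s)
  | b (n : Fin s)
  | l (k : Fin (p - s))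
  | r (k : Fin (p - s))

/-- The vector space underlying `P^±_s`, with basis `ProjBasis p s`. -/
abbrev ProjSpace (p s : ℕ) : Type := ProjBasis p s →₀ ℂ

section Modules

variable (p s : ℕ)

/-- The vector `t_n`, zero if `n` is out of range. -/
def tv (n : ℕ) : ProjSpace p s := if h : n < s then Finsupp.single (.t ⟨n, h⟩) 1 else 0
/-- The vector `b_n`, zero if `n` is out of range. -/
def bv (n : ℕ) : ProjSpace p s := if h : n < s then Finsupp.single (.b ⟨n, h⟩) 1 else 0
/-- The vector `l_k`, zero if `k` is out of range. -/
def lv (k : ℕ) : ProjSpace p s := if h : k < p - s then Finsupp.single (.l ⟨k, h⟩) 1 else 0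
/-- The vector `r_k`, zero if `k` is out of range. -/
def rv (k : ℕ) : ProjSpace p s := if h : k < p - s then Finsupp.single (.r ⟨k, h⟩) 1 else 0

/-- The eigenvalue of `K` on a basis vector of `P^ε_s` (`ε = ±1`). -/
def weight (ε : ℤˣ) : ProjBasis p s → ℂ
  | .t n => ((ε : ℤ) : ℂ) * q p ^ ((s : ℤ) - 1 - 2 * (n : ℕ))
  | .b n => ((ε : ℤ) : ℂ) * q p ^ ((s : ℤ) - 1 - 2 * (n : ℕ))
  | .l k => -((ε : ℤ) : ℂ) * q p ^ ((p : ℤ) - s - 1 - 2 * (k : ℕ))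
  | .r k => -((ε : ℤ) : ℂ) * q p ^ ((p : ℤ) - s - 1 - 2 * (k : ℕ))

/-- The action of `E` on the basis vectors of `P^ε_s`. Note `[0] = 0`, so that
`E b_0 = E l_0 = 0`. -/
def actE (ε : ℤˣ) : ProjBasis p s → ProjSpace p s
  | .t n =>
    if (n : ℕ) = 0 then lv p s (p - s - 1)
    else (((ε : ℤ) : ℂ) * qInt p (n : ℕ) * qInt p ((s : ℤ) - (n : ℕ))) • tv p s (n - 1)
      + bv p s (n - 1)
  | .b n => (((ε : ℤ) : ℂ) * qInt p (n : ℕ) * qInt p ((s : ℤ) - (n : ℕ))) • bv p s (n - 1)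
  | .l k => (-((ε : ℤ) : ℂ) * qInt p (k : ℕ) * qInt p ((p : ℤ) - s - (k : ℕ))) • lv p s (k - 1)
  | .r k =>
    if (k : ℕ) = 0 then bv p s (s - 1)
    else (-((ε : ℤ) : ℂ) * qInt p (k : ℕ) * qInt p ((p : ℤ) - s - (k : ℕ))) • rv p s (k - 1)

/-- The action of `F` on the basis vectors of `P^±_s`. -/
def actF : ProjBasis p s → ProjSpace p s
  | .t n => if (n : ℕ) = s - 1 then rv p s 0 else tv p s (n + 1)
  | .b n => bv p s (n + 1)
  | .l k => if (k : ℕ) = p - s - 1 then bv p s 0 else lv p s (k + 1)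
  | .r k => rv p s (k + 1)

/-- The operator of `E` on `P^ε_s`. -/
def opE (ε : ℤˣ) : Module.End ℂ (ProjSpace p s) := Finsupp.linearCombination ℂ (actE p s ε)
/-- The operator of `F` on `P^ε_s`. -/
def opF : Module.End ℂ (ProjSpace p s) := Finsupp.linearCombination ℂ (actF p s)
/-- The operator of `K` on `P^ε_s`. -/
def opK (ε : ℤˣ) : Module.End ℂ (ProjSpace p s) :=
  Finsupp.linearCombination ℂ fun x => weight p s ε x • Finsupp.single x 1
/-- The operator of `K⁻¹` on `P^ε_s`. -/
def opKinv (ε : ℤˣ) : Module.End ℂ (ProjSpace p s) :=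
  Finsupp.linearCombination ℂ fun x => (weight p s ε x)⁻¹ • Finsupp.single x 1

variable {p s}

theorem tv_of_lt {n : ℕ} (h : n < s) : tv p s n = Finsupp.single (.t ⟨n, h⟩) 1 := dif_pos h
theorem bv_of_lt {n : ℕ} (h : n < s) : bv p s n = Finsupp.single (.b ⟨n, h⟩) 1 := dif_pos h
theorem lv_of_lt {n : ℕ} (h : n < p - s) : lv p s n = Finsupp.single (.l ⟨n, h⟩) 1 := dif_pos h
theorem rv_of_lt {n : ℕ} (h : n < p - s) : rv p s n = Finsupp.single (.r ⟨n, h⟩) 1 := dif_pos h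
theorem bv_of_le {n : ℕ} (h : s ≤ n) : bv p s n = 0 := dif_neg (by omega)
theorem rv_of_le {n : ℕ} (h : p - s ≤ n) : rv p s n = 0 := dif_neg (by omega)

theorem end_ext {f g : Module.End ℂ (ProjSpace p s)}
    (ht : ∀ n, n < s → f (tv p s n) = g (tv p s n))
    (hb : ∀ n, n < s → f (bv p s n) = g (bv p s n))
    (hl : ∀ n, n < p - s → f (lv p s n) = g (lv p s n))
    (hr : ∀ n, n < p - s → f (rv p s n) = g (rv p s n)) : f = g := by
  refine Finsupp.lhom_ext' fun x => LinearMap.ext_ring ?_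
  rcases x with ⟨n, hn⟩ | ⟨n, hn⟩ | ⟨n, hn⟩ | ⟨n, hn⟩
  · simpa [tv_of_lt hn] using ht n hn
  · simpa [bv_of_lt hn] using hb n hn
  · simpa [lv_of_lt hn] using hl n hn
  · simpa [rv_of_lt hn] using hr n hn

variable (ε : ℤˣ)

theorem opK_t (n : ℕ) :
    opK p s ε (tv p s n) = (((ε : ℤ) : ℂ) * q p ^ ((s : ℤ) - 1 - 2 * n)) • tv p s n := by
  by_cases h : n < s
  · simp [tv, h, opK, weight]
  · simp [tv, h]
theorem opK_b (n : ℕ) :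
    opK p s ε (bv p s n) = (((ε : ℤ) : ℂ) * q p ^ ((s : ℤ) - 1 - 2 * n)) • bv p s n := by
  by_cases h : n < s
  · simp [bv, h, opK, weight]
  · simp [bv, h]
theorem opK_l (n : ℕ) :
    opK p s ε (lv p s n) = (-((ε : ℤ) : ℂ) * q p ^ ((p : ℤ) - s - 1 - 2 * n)) • lv p s n := by
  by_cases h : n < p - s
  · simp [lv, h, opK, weight]
  · simp [lv, h]
theorem opK_r (n : ℕ) :
    opK p s ε (rv p s n) = (-((ε : ℤ) : ℂ) * q p ^ ((p : ℤ) - s - 1 - 2 * n)) • rv p s n := by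
  by_cases h : n < p - s
  · simp [rv, h, opK, weight]
  · simp [rv, h]

theorem opE_t_zero (h : 0 < s) : opE p s ε (tv p s 0) = lv p s (p - s - 1) := by
  simp [tv_of_lt h, opE, actE]
theorem opE_t_succ {n : ℕ} (h : n + 1 < s) : opE p s ε (tv p s (n + 1)) =
    (((ε : ℤ) : ℂ) * qInt p (n + 1) * qInt p ((s : ℤ) - (n + 1))) • tv p s n + bv p s n := by
  simp [tv_of_lt h, opE, actE]
theorem opE_b_zero : opE p s ε (bv p s 0) = 0 := by
  by_cases h : 0 < s
  · simp [bv_of_lt h, opE, actE, qInt]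
  · simp [bv, h]
theorem opE_b_succ {n : ℕ} (h : n + 1 < s) : opE p s ε (bv p s (n + 1)) =
    (((ε : ℤ) : ℂ) * qInt p (n + 1) * qInt p ((s : ℤ) - (n + 1))) • bv p s n := by
  simp [bv_of_lt h, opE, actE]
theorem opE_l_zero : opE p s ε (lv p s 0) = 0 := by
  by_cases h : 0 < p - s
  · simp [lv_of_lt h, opE, actE, qInt]
  · simp [lv, h]
theorem opE_l_succ {n : ℕ} (h : n + 1 < p - s) : opE p s ε (lv p s (n + 1)) =
    (-((ε : ℤ) : ℂ) * qInt p (n + 1) * qInt p ((p : ℤ) - s - (n + 1))) • lv p s n := by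
  simp [lv_of_lt h, opE, actE]
theorem opE_r_zero (h : 0 < p - s) : opE p s ε (rv p s 0) = bv p s (s - 1) := by
  simp [rv_of_lt h, opE, actE]
theorem opE_r_succ {n : ℕ} (h : n + 1 < p - s) : opE p s ε (rv p s (n + 1)) =
    (-((ε : ℤ) : ℂ) * qInt p (n + 1) * qInt p ((p : ℤ) - s - (n + 1))) • rv p s n := by
  simp [rv_of_lt h, opE, actE]

theorem opF_t_last (h : 0 < s) : opF p s (tv p s (s - 1)) = rv p s 0 := by
  simp [tv_of_lt (show s - 1 < s by omega), opF, actF]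
theorem opF_t {n : ℕ} (h : n + 1 < s) : opF p s (tv p s n) = tv p s (n + 1) := by
  simp [tv_of_lt (show n < s by omega), opF, actF, show n ≠ s - 1 by omega]
theorem opF_b (n : ℕ) : opF p s (bv p s n) = bv p s (n + 1) := by
  by_cases h : n < s
  · simp [bv_of_lt h, opF, actF]
  · rw [bv_of_le (by omega), bv_of_le (by omega), map_zero]
theorem opF_l_last (h : 0 < p - s) : opF p s (lv p s (p - s - 1)) = bv p s 0 := by
  simp [lv_of_lt (show p - s - 1 < p - s by omega), opF, actF]
theorem opF_l {n : ℕ} (h : n + 1 < p - s) : opF p s (lv p s n) = lv p s (n + 1) := by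
  simp [lv_of_lt (show n < p - s by omega), opF, actF, show n ≠ p - s - 1 by omega]
theorem opF_r (n : ℕ) : opF p s (rv p s n) = rv p s (n + 1) := by
  by_cases h : n < p - s
  · simp [rv_of_lt h, opF, actF]
  · rw [rv_of_le (by omega), rv_of_le (by omega), map_zero]

theorem unit_ne_zero : ((ε : ℤ) : ℂ) ≠ 0 := by exact_mod_cast ε.ne_zero

theorem unit_inv : ((ε : ℤ) : ℂ)⁻¹ = ((ε : ℤ) : ℂ) := by
  rcases Int.units_eq_one_or ε with rfl | rfl <;> simp

theorem weight_ne_zero (x : ProjBasis p s) : weight p s ε x ≠ 0 := by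
  have h1 := unit_ne_zero ε
  have h2 := fun n : ℤ => zpow_ne_zero n (q_ne_zero p)
  rcases x with n | n | n | n <;> simp [weight, h1, h2]

theorem opK_mul_opKinv : opK p s ε * opKinv p s ε = 1 := by
  refine Finsupp.lhom_ext' fun x => LinearMap.ext_ring ?_
  simp [opK, opKinv, weight_ne_zero]

theorem opKinv_mul_opK : opKinv p s ε * opK p s ε = 1 := by
  refine Finsupp.lhom_ext' fun x => LinearMap.ext_ring ?_
  simp [opK, opKinv, weight_ne_zero]

theorem opKinv_of_opK {v : ProjSpace p s} {c : ℂ} (hc : c ≠ 0) (h : opK p s ε v = c • v) :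
    opKinv p s ε v = c⁻¹ • v := by
  have h1 : opKinv p s ε (opK p s ε v) = v := LinearMap.congr_fun (opKinv_mul_opK ε) v
  rw [h, map_smul] at h1
  rw [← h1, smul_smul, inv_mul_cancel₀ hc, one_smul, h1]

theorem opKinv_t (n : ℕ) :
    opKinv p s ε (tv p s n) = (((ε : ℤ) : ℂ) * q p ^ (-((s : ℤ) - 1 - 2 * n))) • tv p s n := by
  rw [opKinv_of_opK ε (mul_ne_zero (unit_ne_zero ε) (zpow_ne_zero _ (q_ne_zero p))) (opK_t ε n),
    mul_inv, unit_inv, zpow_neg]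
theorem opKinv_b (n : ℕ) :
    opKinv p s ε (bv p s n) = (((ε : ℤ) : ℂ) * q p ^ (-((s : ℤ) - 1 - 2 * n))) • bv p s n := by
  rw [opKinv_of_opK ε (mul_ne_zero (unit_ne_zero ε) (zpow_ne_zero _ (q_ne_zero p))) (opK_b ε n),
    mul_inv, unit_inv, zpow_neg]
theorem opKinv_l (n : ℕ) : opKinv p s ε (lv p s n) =
    (-((ε : ℤ) : ℂ) * q p ^ (-((p : ℤ) - s - 1 - 2 * n))) • lv p s n := by
  rw [opKinv_of_opK ε (mul_ne_zero (neg_ne_zero.mpr (unit_ne_zero ε))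
    (zpow_ne_zero _ (q_ne_zero p))) (opK_l ε n), mul_inv, inv_neg, unit_inv, zpow_neg]
theorem opKinv_r (n : ℕ) : opKinv p s ε (rv p s n) =
    (-((ε : ℤ) : ℂ) * q p ^ (-((p : ℤ) - s - 1 - 2 * n))) • rv p s n := by
  rw [opKinv_of_opK ε (mul_ne_zero (neg_ne_zero.mpr (unit_ne_zero ε))
    (zpow_ne_zero _ (q_ne_zero p))) (opK_r ε n), mul_inv, inv_neg, unit_inv, zpow_neg]

theorem q_zpow_p (hp : 0 < p) : q p ^ (p : ℤ) = -1 := by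
  rw [zpow_natCast, q_pow_p hp]

theorem q_zpow_p_add (hp : 0 < p) (a : ℤ) : q p ^ ((p : ℤ) + a) = -q p ^ a := by
  rw [zpow_add₀ (q_ne_zero p), q_zpow_p hp, neg_one_mul]

theorem opK_opE (h1 : 1 ≤ s) (h2 : s ≤ p - 1) :
    opK p s ε * opE p s ε = (q p ^ (2 : ℤ)) • (opE p s ε * opK p s ε) := by
  have hp : 0 < p := by omega
  have hq := q_ne_zero p
  apply end_ext <;> intro n hn <;> simp only [Module.End.mul_apply, LinearMap.smul_apply]
  · cases n with
    | zero =>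
      rw [opE_t_zero ε (by omega), opK_t, map_smul, opE_t_zero ε (by omega), opK_l, smul_smul]
      congr 1
      rw [show (p : ℤ) - s - 1 - 2 * ((p - s - 1 : ℕ) : ℤ) = -(p : ℤ) + (2 + (s - 1)) by
        push_cast [show s ≤ p by omega, show 1 ≤ p - s by omega]; ring,
        zpow_add₀ hq, zpow_add₀ hq, zpow_neg, q_zpow_p hp]
      simp
      ring
    | succ n =>
      rw [opE_t_succ ε hn, opK_t, map_smul, opE_t_succ ε hn, map_add, map_smul, opK_t, opK_b]
      rw [show (s : ℤ) - 1 - 2 * (n : ℤ) = 2 + (s - 1 - 2 * ((n + 1 : ℕ) : ℤ)) by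
        push_cast; ring, zpow_add₀ hq]
      module
  · cases n with
    | zero => rw [opE_b_zero, opK_b, map_smul, opE_b_zero]; simp
    | succ n =>
      rw [opE_b_succ ε hn, opK_b, map_smul, map_smul, opE_b_succ ε hn, opK_b]
      rw [show (s : ℤ) - 1 - 2 * (n : ℤ) = 2 + (s - 1 - 2 * ((n + 1 : ℕ) : ℤ)) by
        push_cast; ring, zpow_add₀ hq]
      module
  · cases n with
    | zero => rw [opE_l_zero, opK_l, map_smul, opE_l_zero]; simp
    | succ n =>
      rw [opE_l_succ ε hn, opK_l, map_smul, map_smul, opE_l_succ ε hn, opK_l]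
      rw [show (p : ℤ) - s - 1 - 2 * (n : ℤ) = 2 + (p - s - 1 - 2 * ((n + 1 : ℕ) : ℤ)) by
        push_cast; ring, zpow_add₀ hq]
      module
  · cases n with
    | zero =>
      rw [opE_r_zero ε (by omega), opK_r, map_smul, opE_r_zero ε (by omega), opK_b, smul_smul]
      congr 1
      rw [show (s : ℤ) - 1 - 2 * ((s - 1 : ℕ) : ℤ) = -s + 1 by
        push_cast [h1]; ring,
        show (p : ℤ) - s - 1 - 2 * ((0 : ℕ) : ℤ) = p + (-s - 1) by push_cast; ring,
        q_zpow_p_add hp, show -(s : ℤ) + 1 = 2 + (-s - 1) by ring, zpow_add₀ hq 2]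
      ring
    | succ n =>
      rw [opE_r_succ ε hn, opK_r, map_smul, map_smul, opE_r_succ ε hn, opK_r]
      rw [show (p : ℤ) - s - 1 - 2 * (n : ℤ) = 2 + (p - s - 1 - 2 * ((n + 1 : ℕ) : ℤ)) by
        push_cast; ring, zpow_add₀ hq]
      module

theorem opK_opF (h1 : 1 ≤ s) (h2 : s ≤ p - 1) :
    opK p s ε * opF p s = (q p ^ (-2 : ℤ)) • (opF p s * opK p s ε) := by
  have hp : 0 < p := by omega
  have hq := q_ne_zero p
  apply end_ext <;> intro n hn <;> simp only [Module.End.mul_apply, LinearMap.smul_apply]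
  · rw [opK_t, map_smul]
    by_cases h : n + 1 < s
    · rw [opF_t h, opK_t, smul_smul, show (s : ℤ) - 1 - 2 * ((n + 1 : ℕ) : ℤ) =
        -2 + (s - 1 - 2 * (n : ℤ)) by push_cast; ring, zpow_add₀ hq]
      congr 1
      ring
    · obtain rfl : n = s - 1 := by omega
      rw [opF_t_last (by omega), opK_r, smul_smul]
      congr 1
      rw [show (s : ℤ) - 1 - 2 * ((s - 1 : ℕ) : ℤ) = -s + 1 by
        push_cast [h1]; ring,
        show (p : ℤ) - s - 1 - 2 * ((0 : ℕ) : ℤ) = p + (-2 + (-s + 1)) by push_cast; ring,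
        q_zpow_p_add hp, zpow_add₀ hq (-2)]
      ring
  · rw [opF_b, opK_b, opK_b, map_smul, opF_b, smul_smul,
      show (s : ℤ) - 1 - 2 * ((n + 1 : ℕ) : ℤ) =
        -2 + (s - 1 - 2 * (n : ℤ)) by push_cast; ring, zpow_add₀ hq]
    congr 1
    ring
  · rw [opK_l, map_smul]
    by_cases h : n + 1 < p - s
    · rw [opF_l h, opK_l, smul_smul, show (p : ℤ) - s - 1 - 2 * ((n + 1 : ℕ) : ℤ) =
        -2 + (p - s - 1 - 2 * (n : ℤ)) by push_cast; ring, zpow_add₀ hq]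
      congr 1
      ring
    · obtain rfl : n = p - s - 1 := by omega
      rw [opF_l_last (by omega), opK_b, smul_smul]
      congr 1
      rw [show (p : ℤ) - s - 1 - 2 * ((p - s - 1 : ℕ) : ℤ) = -(p : ℤ) + (s + 1) by
        push_cast [show s ≤ p by omega, show 1 ≤ p - s by omega]; ring,
        show (s : ℤ) - 1 - 2 * ((0 : ℕ) : ℤ) = -2 + (s + 1) by push_cast; ring,
        zpow_add₀ hq (-2), zpow_add₀ hq (-p), zpow_neg _ (p : ℤ), q_zpow_p hp]
      simp
      ring
  · rw [opF_r, opK_r, opK_r, map_smul, opF_r, smul_smul,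
      show (p : ℤ) - s - 1 - 2 * ((n + 1 : ℕ) : ℤ) =
        -2 + (p - s - 1 - 2 * (n : ℤ)) by push_cast; ring, zpow_add₀ hq]
    congr 1
    ring

theorem qInt_rel (hp : 2 ≤ p) (n m : ℤ) :
    qInt p (n + 1) * qInt p (m - (n + 1)) - qInt p n * qInt p (m - n) =
      (q p - (q p)⁻¹)⁻¹ * (q p ^ (m - 1 - 2 * n) - q p ^ (-(m - 1 - 2 * n))) := by
  have hq := q_ne_zero p
  have hd := q_sub_inv_ne_zero hp
  have hx := zpow_ne_zero n hq
  have hy := zpow_ne_zero m hq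
  have e1 : ∀ a b : ℤ, q p ^ (a - b) = q p ^ a / q p ^ b := fun a b => zpow_sub₀ hq a b
  have hD : q p - (q p)⁻¹ = (q p ^ 2 - 1) / q p := by field_simp
  have hd2 : q p ^ 2 - 1 ≠ 0 := by
    intro h
    rw [hD, h, zero_div] at hd
    exact hd rfl
  simp only [qInt, zpow_neg, e1, zpow_add₀ hq, two_mul, zpow_one]
  rw [hD]
  field_simp
  ring

theorem qInt_zero : qInt p 0 = 0 := by simp [qInt]
theorem qInt_one (hp : 2 ≤ p) : qInt p 1 = 1 := by
  simp [qInt, div_self (q_sub_inv_ne_zero hp)]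

theorem opE_opF (h1 : 1 ≤ s) (h2 : s ≤ p - 1) :
    opE p s ε * opF p s - opF p s * opE p s ε =
      (q p - (q p)⁻¹)⁻¹ • (opK p s ε - opKinv p s ε) := by
  have hp : 2 ≤ p := by omega
  apply end_ext <;> intro n hn <;>
    simp only [Module.End.mul_apply, LinearMap.smul_apply, LinearMap.sub_apply]
  · rw [opK_t, opKinv_t, ← sub_smul, ← mul_sub, smul_smul, mul_left_comm, ← qInt_rel hp]
    have hEF : opE p s ε (opF p s (tv p s n)) =
        (((ε : ℤ) : ℂ) * qInt p (n + 1) * qInt p ((s : ℤ) - (n + 1))) • tv p s n + bv p s n := by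
      by_cases h : n + 1 < s
      · rw [opF_t h, opE_t_succ ε h]
      · obtain rfl : n = s - 1 := by omega
        rw [opF_t_last (by omega), opE_r_zero ε (by omega),
          show (s : ℤ) - (((s - 1 : ℕ) : ℤ) + 1) = 0 by push_cast [h1]; ring, qInt_zero]
        simp
    have hFE : opF p s (opE p s ε (tv p s n)) =
        (((ε : ℤ) : ℂ) * qInt p n * qInt p ((s : ℤ) - n)) • tv p s n + bv p s n := by
      cases n with
      | zero =>
        rw [opE_t_zero ε (by omega), opF_l_last (by omega)]
        simp [qInt_zero]
      | succ n =>
        rw [opE_t_succ ε hn, map_add, map_smul, opF_t hn, opF_b]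
        push_cast
        rfl
    rw [hEF, hFE]
    module
  · rw [opK_b, opKinv_b, ← sub_smul, ← mul_sub, smul_smul, mul_left_comm, ← qInt_rel hp]
    have hEF : opE p s ε (opF p s (bv p s n)) =
        (((ε : ℤ) : ℂ) * qInt p (n + 1) * qInt p ((s : ℤ) - (n + 1))) • bv p s n := by
      rw [opF_b]
      by_cases h : n + 1 < s
      · rw [opE_b_succ ε h]
      · obtain rfl : n = s - 1 := by omega
        rw [bv_of_le (by omega),
          show (s : ℤ) - (((s - 1 : ℕ) : ℤ) + 1) = 0 by push_cast [h1]; ring, qInt_zero]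
        simp
    have hFE : opF p s (opE p s ε (bv p s n)) =
        (((ε : ℤ) : ℂ) * qInt p n * qInt p ((s : ℤ) - n)) • bv p s n := by
      cases n with
      | zero =>
        rw [opE_b_zero]
        simp [qInt_zero]
      | succ n =>
        rw [opE_b_succ ε hn, map_smul, opF_b]
        push_cast
        rfl
    rw [hEF, hFE]
    module
  · rw [opK_l, opKinv_l, ← sub_smul, ← mul_sub, smul_smul, mul_left_comm, ← qInt_rel hp]
    have hEF : opE p s ε (opF p s (lv p s n)) =
        (-((ε : ℤ) : ℂ) * qInt p (n + 1) * qInt p ((p : ℤ) - s - (n + 1))) • lv p s n := by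
      by_cases h : n + 1 < p - s
      · rw [opF_l h, opE_l_succ ε h]
      · obtain rfl : n = p - s - 1 := by omega
        rw [opF_l_last (by omega), opE_b_zero,
          show (p : ℤ) - s - (((p - s - 1 : ℕ) : ℤ) + 1) = 0 by
            push_cast [show s ≤ p by omega, show 1 ≤ p - s by omega]; ring, qInt_zero]
        simp
    have hFE : opF p s (opE p s ε (lv p s n)) =
        (-((ε : ℤ) : ℂ) * qInt p n * qInt p ((p : ℤ) - s - n)) • lv p s n := by
      cases n with
      | zero =>
        rw [opE_l_zero]
        simp [qInt_zero]
      | succ n =>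
        rw [opE_l_succ ε hn, map_smul, opF_l hn]
        push_cast
        rfl
    rw [hEF, hFE]
    module
  · rw [opK_r, opKinv_r, ← sub_smul, ← mul_sub, smul_smul, mul_left_comm, ← qInt_rel hp]
    have hEF : opE p s ε (opF p s (rv p s n)) =
        (-((ε : ℤ) : ℂ) * qInt p (n + 1) * qInt p ((p : ℤ) - s - (n + 1))) • rv p s n := by
      rw [opF_r]
      by_cases h : n + 1 < p - s
      · rw [opE_r_succ ε h]
      · obtain rfl : n = p - s - 1 := by omega
        rw [rv_of_le (by omega),
          show (p : ℤ) - s - (((p - s - 1 : ℕ) : ℤ) + 1) = 0 by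
            push_cast [show s ≤ p by omega, show 1 ≤ p - s by omega]; ring, qInt_zero]
        simp
    have hFE : opF p s (opE p s ε (rv p s n)) =
        (-((ε : ℤ) : ℂ) * qInt p n * qInt p ((p : ℤ) - s - n)) • rv p s n := by
      cases n with
      | zero =>
        rw [opE_r_zero ε (by omega), opF_b, bv_of_le (by omega)]
        simp [qInt_zero]
      | succ n =>
        rw [opE_r_succ ε hn, map_smul, opF_r]
        push_cast
        rfl
    rw [hEF, hFE]
    module

/-- An operator that lowers a height function on the basis is nilpotent. -/
theorem pow_eq_zero_of_height {f : Module.End ℂ (ProjSpace p s)} (ht : ProjBasis p s → ℕ)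
    (hlt : ∀ x, ht x < p)
    (hf : ∀ x, f (Finsupp.single x 1) ∈
      Submodule.span ℂ ((fun y => Finsupp.single y (1 : ℂ)) '' {y | ht y < ht x})) :
    f ^ p = 0 := by
  have key : ∀ m x, ht x < m → (f ^ m) (Finsupp.single x 1) = 0 := by
    intro m
    induction m with
    | zero => intro x hx; omega
    | succ m ih =>
      intro x hx
      rw [pow_succ, Module.End.mul_apply]
      have hle : Submodule.span ℂ ((fun y => Finsupp.single y (1 : ℂ)) '' {y | ht y < ht x}) ≤
          LinearMap.ker (f ^ m) := by
        rw [Submodule.span_le]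
        rintro _ ⟨y, hy, rfl⟩
        have hy' : ht y < ht x := hy
        exact ih y (by omega)
      exact hle (hf x)
  refine Finsupp.lhom_ext' fun x => LinearMap.ext_ring ?_
  simpa using key p x (hlt x)

/-- Heights for `E`. -/
def heightE : ProjBasis p s → ℕ
  | .t n => p - s + n
  | .b n => n
  | .l k => k
  | .r k => s + k

/-- Heights for `F`. -/
def heightF : ProjBasis p s → ℕ
  | .t n => p - 1 - n
  | .b n => s - 1 - n
  | .l k => p - 1 - k
  | .r k => p - s - 1 - k

section Span

variable {ht : ProjBasis p s → ℕ} {m : ℕ}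

theorem tv_mem {n : ℕ} (h : ∀ hn : n < s, ht (.t ⟨n, hn⟩) < m) : tv p s n ∈
    Submodule.span ℂ ((fun y => Finsupp.single y (1 : ℂ)) '' {y | ht y < m}) := by
  by_cases hn : n < s
  · rw [tv_of_lt hn]; exact Submodule.subset_span ⟨_, h hn, rfl⟩
  · rw [tv, dif_neg hn]; exact Submodule.zero_mem _
theorem bv_mem {n : ℕ} (h : ∀ hn : n < s, ht (.b ⟨n, hn⟩) < m) : bv p s n ∈
    Submodule.span ℂ ((fun y => Finsupp.single y (1 : ℂ)) '' {y | ht y < m}) := by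
  by_cases hn : n < s
  · rw [bv_of_lt hn]; exact Submodule.subset_span ⟨_, h hn, rfl⟩
  · rw [bv, dif_neg hn]; exact Submodule.zero_mem _
theorem lv_mem {n : ℕ} (h : ∀ hn : n < p - s, ht (.l ⟨n, hn⟩) < m) : lv p s n ∈
    Submodule.span ℂ ((fun y => Finsupp.single y (1 : ℂ)) '' {y | ht y < m}) := by
  by_cases hn : n < p - s
  · rw [lv_of_lt hn]; exact Submodule.subset_span ⟨_, h hn, rfl⟩
  · rw [lv, dif_neg hn]; exact Submodule.zero_mem _
theorem rv_mem {n : ℕ} (h : ∀ hn : n < p - s, ht (.r ⟨n, hn⟩) < m) : rv p s n ∈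
    Submodule.span ℂ ((fun y => Finsupp.single y (1 : ℂ)) '' {y | ht y < m}) := by
  by_cases hn : n < p - s
  · rw [rv_of_lt hn]; exact Submodule.subset_span ⟨_, h hn, rfl⟩
  · rw [rv, dif_neg hn]; exact Submodule.zero_mem _

end Span

theorem opE_pow (h1 : 1 ≤ s) (h2 : s ≤ p - 1) : opE p s ε ^ p = 0 := by
  refine pow_eq_zero_of_height heightE ?_ ?_
  · rintro (⟨n, hn⟩ | ⟨n, hn⟩ | ⟨n, hn⟩ | ⟨n, hn⟩) <;> simp only [heightE] <;> omega
  · rintro (⟨n, hn⟩ | ⟨n, hn⟩ | ⟨n, hn⟩ | ⟨n, hn⟩)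
    · rw [← tv_of_lt hn]
      cases n with
      | zero =>
        rw [opE_t_zero ε hn]
        exact lv_mem fun _ => by simp only [heightE]; omega
      | succ n =>
        rw [opE_t_succ ε hn]
        exact Submodule.add_mem _
          (Submodule.smul_mem _ _ (tv_mem fun _ => by simp only [heightE]; omega))
          (bv_mem fun _ => by simp only [heightE]; omega)
    · rw [← bv_of_lt hn]
      cases n with
      | zero => rw [opE_b_zero]; exact Submodule.zero_mem _
      | succ n =>
        rw [opE_b_succ ε hn]
        exact Submodule.smul_mem _ _ (bv_mem fun _ => by simp only [heightE]; omega)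
    · rw [← lv_of_lt hn]
      cases n with
      | zero => rw [opE_l_zero]; exact Submodule.zero_mem _
      | succ n =>
        rw [opE_l_succ ε hn]
        exact Submodule.smul_mem _ _ (lv_mem fun _ => by simp only [heightE]; omega)
    · rw [← rv_of_lt hn]
      cases n with
      | zero =>
        rw [opE_r_zero ε hn]
        exact bv_mem fun _ => by simp only [heightE]; omega
      | succ n =>
        rw [opE_r_succ ε hn]
        exact Submodule.smul_mem _ _ (rv_mem fun _ => by simp only [heightE]; omega)

theorem opF_pow (h1 : 1 ≤ s) (h2 : s ≤ p - 1) : opF p s ^ p = 0 := by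
  refine pow_eq_zero_of_height heightF ?_ ?_
  · rintro (⟨n, hn⟩ | ⟨n, hn⟩ | ⟨n, hn⟩ | ⟨n, hn⟩) <;> simp only [heightF] <;> omega
  · rintro (⟨n, hn⟩ | ⟨n, hn⟩ | ⟨n, hn⟩ | ⟨n, hn⟩)
    · rw [← tv_of_lt hn]
      by_cases h : n + 1 < s
      · rw [opF_t h]
        exact tv_mem fun _ => by simp only [heightF]; omega
      · obtain rfl : n = s - 1 := by omega
        rw [opF_t_last (by omega)]
        exact rv_mem fun _ => by simp only [heightF]; omega
    · rw [← bv_of_lt hn, opF_b]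
      exact bv_mem fun _ => by simp only [heightF]; omega
    · rw [← lv_of_lt hn]
      by_cases h : n + 1 < p - s
      · rw [opF_l h]
        exact lv_mem fun _ => by simp only [heightF]; omega
      · obtain rfl : n = p - s - 1 := by omega
        rw [opF_l_last (by omega)]
        exact bv_mem fun _ => by simp only [heightF]; omega
    · rw [← rv_of_lt hn, opF_r]
      exact rv_mem fun _ => by simp only [heightF]; omega

theorem weight_pow (hp : 0 < p) (x : ProjBasis p s) : weight p s ε x ^ (2 * p) = 1 := by
  have h1 : ((ε : ℤ) : ℂ) ^ 2 = 1 := by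
    rcases Int.units_eq_one_or ε with rfl | rfl <;> simp
  have h2 : ∀ n : ℤ, (q p ^ n) ^ (2 * p) = 1 := by
    intro n
    rw [← zpow_natCast, ← zpow_mul, mul_comm, zpow_mul, zpow_natCast, mul_comm 2, pow_mul,
      q_pow_p hp]
    simp
  rcases x with n | n | n | n <;> simp only [weight, mul_pow, h2, mul_one]
  · rw [pow_mul, h1, one_pow]
  · rw [pow_mul, h1, one_pow]
  · rw [pow_mul, neg_sq, h1, one_pow]
  · rw [pow_mul, neg_sq, h1, one_pow]

theorem opK_pow (hp : 0 < p) : opK p s ε ^ (2 * p) = 1 := by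
  refine Finsupp.lhom_ext' fun x => LinearMap.ext_ring ?_
  have h : ∀ m : ℕ, (opK p s ε ^ m) (Finsupp.single x 1) =
      weight p s ε x ^ m • Finsupp.single x 1 := by
    intro m
    induction m with
    | zero => simp
    | succ m ih =>
      rw [pow_succ', Module.End.mul_apply, ih, map_smul]
      have : opK p s ε (Finsupp.single x 1) = weight p s ε x • Finsupp.single x 1 := by
        simp [opK]
      rw [this, smul_smul, pow_succ]
  have h2 := h (2 * p)
  rw [weight_pow ε hp, one_smul] at h2
  simpa using h2

theorem satisfies_proj (h1 : 1 ≤ s) (h2 : s ≤ p - 1) :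
    Satisfies p (opE p s ε) (opF p s) (opK p s ε) (opKinv p s ε) where
  k_ki := opK_mul_opKinv ε
  ki_k := opKinv_mul_opK ε
  k_e := by
    rw [opK_opE ε h1 h2, smul_mul_assoc, mul_assoc, opK_mul_opKinv, mul_one]
  k_f := by
    rw [opK_opF ε h1 h2, smul_mul_assoc, mul_assoc, opK_mul_opKinv, mul_one]
  e_f := opE_opF ε h1 h2
  e_pow := opE_pow ε h1 h2
  f_pow := opF_pow h1 h2
  k_pow := opK_pow ε (by omega)

end Modules

/-- The action of the restricted quantum group on the projective module `P^ε_s`,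
`1 ≤ s ≤ p - 1`. -/
def projRep (p : ℕ) (ε : ℤˣ) (s : ℕ) (h1 : 1 ≤ s) (h2 : s ≤ p - 1) :
    RestrictedUqSL2 p →ₐ[ℂ] Module.End ℂ (ProjSpace p s) :=
  lift (satisfies_proj ε h1 h2)

/-- The action on `P^+_s ⊕ P^-_{p-s}`, `1 ≤ s ≤ p - 1`. -/
def sumRep (p s : ℕ) (h1 : 1 ≤ s) (h2 : s ≤ p - 1) :
    RestrictedUqSL2 p →ₐ[ℂ] Module.End ℂ (ProjSpace p s × ProjSpace p (p - s)) :=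
  (LinearMap.prodMapAlgHom ℂ (ProjSpace p s) (ProjSpace p (p - s))).comp
    ((projRep p 1 s h1 h2).prod (projRep p (-1) (p - s) (by omega) (by omega)))

/-- The endomorphism of the vector space `P^±_s` with `b_n ↦ α t_n + β b_n` that kills all the
other basis vectors. -/
def sigmaBlock (p s : ℕ) (α β : ℂ) : Module.End ℂ (ProjSpace p s) :=
  Finsupp.linearCombination ℂ fun x : ProjBasis p s =>
    match x with
    | .b n => α • Finsupp.single (.t n) 1 + β • Finsupp.single (.b n) 1
    | _ => 0

/-- The map `σ_s` on `P^+_s ⊕ P^-_{p-s}`: `b^±_n ↦ α^± t^±_n + β^± b^±_n`, and zero on the other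
basis vectors. -/
def sigma (p s : ℕ) (αp αm βp βm : ℂ) : Module.End ℂ (ProjSpace p s × ProjSpace p (p - s)) :=
  LinearMap.prodMap (sigmaBlock p s αp βp) (sigmaBlock p (p - s) αm βm)

/-- The balancing element `g = K^(p+1)`. -/
def balancing (p : ℕ) : (RestrictedUqSL2 p)ˣ := Ku p ^ (p + 1)

/-- The functional `γ(s) : x ↦ Tr (g⁻¹ x σ_s)`, the trace being over `P^+_s ⊕ P^-_{p-s}`. -/
def gammaFun (p s : ℕ) (h1 : 1 ≤ s) (h2 : s ≤ p - 1) (αp αm βp βm : ℂ) :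
    Module.Dual ℂ (RestrictedUqSL2 p) :=
  LinearMap.trace ℂ (ProjSpace p s × ProjSpace p (p - s)) ∘ₗ
    LinearMap.mulRight ℂ (sigma p s αp αm βp βm) ∘ₗ
    (sumRep p s h1 h2).toLinearMap ∘ₗ
    LinearMap.mulLeft ℂ (((balancing p)⁻¹ : (RestrictedUqSL2 p)ˣ) : RestrictedUqSL2 p)

end UqSL2

end

/-!
The square of the antipode is conjugation by `g = K^(p+1)`
(`antipode_antipode_mul_balancing`), so by cyclicity of the trace the functional
`x ↦ Tr (g⁻¹ x σ)` is a q-character if and only if `Tr (x [y, σ]) = 0` for all `x`, `y` in the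
algebra (`gammaFun_mem_iff`). The elements `y` with this property for all `x` form a subalgebra, so
it is enough to take for `y` the generators (`trace_commutator_eq_zero`), and `σ` commutes with `K`.

On one block `P^ε_s`, the commutator `[E, σ]` equals `[j, τ] + α (R - R')`, where `j : t_n ↦ b_n` is
a module endomorphism, `τ` is some operator, and `R : b_0 ↦ l_{p-s-1}`, `R' : r_0 ↦ t_{s-1}` have
rank one (`commutator_opE_sigmaBlock`). The term `[j, τ]` is trace-orthogonal to the action, and `R`,
`R'` contribute the matrix coefficients from `l_{p-s-1}` to `b_0` and from `t_{s-1}` to `r_0`. The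
module map `P^ε_s → P^{-ε}_{p-s}`, `t_n ↦ l_n`, `r_k ↦ b_k`, identifies the second of these with the
first one of the other block. The two blocks together therefore give
`Tr (x [E, σ]) = (α^+ - α^-) (c(x) - c'(x))` with matrix coefficients `c`, `c'` of `P^+_s`
(`trace_commutator_E`), and `F` is similar, with the module map `t_n ↦ r_n`, `l_k ↦ b_k`
(`trace_commutator_F`). All of this vanishes if `α^+ = α^-`. Conversely, at `x = F K` the difference
`c(x) - c'(x)` is `q^(1+s) - q^(1-s)`, which is nonzero because `q^2` is a primitive `p`-th root of
unity and `0 < s < p` (`coeff_F_mul_K_ne_zero`).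
-/

noncomputable section

namespace UqSL2

/-! ### The square of the antipode -/

section Antipode

variable (p : ℕ) [NeZero p]

theorem pow_q_sq_succ : (q p ^ 2) ^ (p + 1) = q p ^ 2 := by
  rw [pow_succ, (q_sq_primitive (Nat.pos_of_ne_zero (NeZero.ne p))).pow_eq_one, one_mul]

/-- The square of the antipode is conjugation by the balancing element. -/
theorem antipode_antipode_mul_balancing (y : RestrictedUqSL2 p) :
    HopfAlgebra.antipode ℂ (HopfAlgebra.antipode ℂ y) * (balancing p : RestrictedUqSL2 p) =
      (balancing p : RestrictedUqSL2 p) * y := by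
  have h := satisfies_gen p
  have hg : (balancing p : RestrictedUqSL2 p) = K p ^ (p + 1) := by simp [balancing, K]
  rw [hg]
  change antipodeLin p (antipodeLin p y) * _ = _
  induction y using induct with
  | hc c =>
    rw [antipodeLin_algebraMap, antipodeLin_algebraMap]
    exact Algebra.commutes c _
  | hE =>
    have hq := pow_ne_zero 2 (q_ne_zero p)
    have hek : E p * K p = (q p ^ 2)⁻¹ • (K p * E p) := by
      rw [h.ke, smul_smul, inv_mul_cancel₀ hq, one_smul]
    rw [antipodeLin_E, map_neg, antipodeLin_mul, antipodeLin_E, antipodeLin_Kinv, mul_neg,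
      neg_neg, ← mul_assoc, h.k_e, smul_mul_assoc, mul_pow_of_qcomm hek, inv_pow, pow_q_sq_succ,
      smul_smul, show q p ^ (2 : ℤ) = q p ^ 2 from zpow_natCast _ 2, mul_inv_cancel₀ hq, one_smul]
  | hF =>
    have hq := pow_ne_zero 2 (q_ne_zero p)
    rw [antipodeLin_F, map_neg, antipodeLin_mul, antipodeLin_F, antipodeLin_K, neg_mul,
      neg_mul, neg_mul, neg_neg, h.k_f, smul_mul_assoc, mul_pow_of_qcomm h.kf, pow_q_sq_succ,
      smul_smul, zpow_neg, show q p ^ (2 : ℤ) = q p ^ 2 from zpow_natCast _ 2,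
      inv_mul_cancel₀ hq, one_smul]
  | hK => rw [antipodeLin_K, antipodeLin_Kinv, ← pow_succ, ← pow_succ']
  | hK' =>
    have hc : Commute (Kinv p) (K p) := by rw [Commute, SemiconjBy, h.k_ki, h.ki_k]
    rw [antipodeLin_Kinv, antipodeLin_K]
    exact hc.pow_right _
  | hmul a b ha hb =>
    rw [antipodeLin_mul, antipodeLin_mul, mul_assoc, hb, ← mul_assoc, ha, mul_assoc]
  | hadd a b ha hb => rw [map_add, map_add, add_mul, ha, hb, mul_add]

end Antipode

/-- Cyclicity of the trace, for a product with a commutator. -/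
theorem trace_mul_commutator {V : Type*} [AddCommGroup V] [Module ℂ V] (a b c : Module.End ℂ V) :
    LinearMap.trace ℂ V (a * (b * c - c * b)) =
      LinearMap.trace ℂ V (a * b * c) - LinearMap.trace ℂ V (b * a * c) := by
  rw [mul_sub, map_sub, mul_assoc, mul_assoc b, LinearMap.trace_mul_comm ℂ b, mul_assoc a c b]

/-- A trace functional `x ↦ Tr (g⁻¹ x σ)` is a q-character if and only if `σ` commutes with the
action up to operators that are trace-orthogonal to the image of the algebra. -/
theorem gammaFun_mem_iff (p : ℕ) [NeZero p] (s : ℕ) (hs : 1 ≤ s) (hsp : s ≤ p - 1)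
    (αp αm βp βm : ℂ) :
    gammaFun p s hs hsp αp αm βp βm ∈ qCharacters ℂ (RestrictedUqSL2 p) ↔
      ∀ y x : RestrictedUqSL2 p, LinearMap.trace ℂ _ (sumRep p s hs hsp x *
        (sumRep p s hs hsp y * sigma p s αp αm βp βm -
          sigma p s αp αm βp βm * sumRep p s hs hsp y)) = 0 := by
  set ρ := sumRep p s hs hsp with hρ
  set σ := sigma p s αp αm βp βm with hσ
  have happ : ∀ z, gammaFun p s hs hsp αp αm βp βm z = LinearMap.trace ℂ _
      (ρ (((balancing p)⁻¹ : (RestrictedUqSL2 p)ˣ) * z) * σ) := fun z => rfl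
  have key : ∀ x y, gammaFun p s hs hsp αp αm βp βm (x * y) -
      gammaFun p s hs hsp αp αm βp βm
        (HopfAlgebra.antipode ℂ (HopfAlgebra.antipode ℂ y) * x) =
      LinearMap.trace ℂ _ (ρ (((balancing p)⁻¹ : (RestrictedUqSL2 p)ˣ) * x) *
        (ρ y * σ - σ * ρ y)) := by
    intro x y
    have h1 : (((balancing p)⁻¹ : (RestrictedUqSL2 p)ˣ) : RestrictedUqSL2 p) *
        (HopfAlgebra.antipode ℂ (HopfAlgebra.antipode ℂ y) * x) =
        y * (((balancing p)⁻¹ : (RestrictedUqSL2 p)ˣ) * x) := by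
      rw [← mul_assoc, ← mul_assoc]
      congr 1
      rw [Units.inv_mul_eq_iff_eq_mul, ← mul_assoc, ← antipode_antipode_mul_balancing,
        Units.mul_inv_cancel_right]
    rw [happ, happ, h1, ← mul_assoc, map_mul ρ _ y, map_mul ρ y, trace_mul_commutator]
  constructor
  · intro h y x
    have := key ((balancing p : RestrictedUqSL2 p) * x) y
    rw [h, sub_self, Units.inv_mul_cancel_left] at this
    exact this.symm
  · intro h x y
    rw [← sub_eq_zero, key, h]

/-! ### Linear maps out of the projective modules -/

instance (p s : ℕ) : Finite (ProjBasis p s) := by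
  refine Finite.of_injective (β := (Fin s ⊕ Fin s) ⊕ (Fin (p - s) ⊕ Fin (p - s)))
    (fun x => match x with
      | .t n => .inl (.inl n)
      | .b n => .inl (.inr n)
      | .l n => .inr (.inl n)
      | .r n => .inr (.inr n)) ?_
  rintro (x | x | x | x) (y | y | y | y) h <;> simp_all

section Blocks

variable {p s : ℕ}

/-- Linear maps out of `P^±_s` agree if they agree on the vectors `t_n`, `b_n`, `l_k`, `r_k`. -/
theorem hom_ext_proj {V : Type*} [AddCommGroup V] [Module ℂ V] {f g : ProjSpace p s →ₗ[ℂ] V}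
    (ht : ∀ n, n < s → f (tv p s n) = g (tv p s n))
    (hb : ∀ n, n < s → f (bv p s n) = g (bv p s n))
    (hl : ∀ n, n < p - s → f (lv p s n) = g (lv p s n))
    (hr : ∀ n, n < p - s → f (rv p s n) = g (rv p s n)) : f = g := by
  refine Finsupp.lhom_ext' fun x => LinearMap.ext_ring ?_
  rcases x with ⟨n, hn⟩ | ⟨n, hn⟩ | ⟨n, hn⟩ | ⟨n, hn⟩
  · simpa [tv_of_lt hn] using ht n hn
  · simpa [bv_of_lt hn] using hb n hn
  · simpa [lv_of_lt hn] using hl n hn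
  · simpa [rv_of_lt hn] using hr n hn

/-- The linear map out of `P^±_s` that takes the values `T n`, `B n`, `L k`, `R k` on the basis
vectors `t_n`, `b_n`, `l_k`, `r_k`. -/
def mkHom (p s : ℕ) {V : Type*} [AddCommGroup V] [Module ℂ V] (T B L R : ℕ → V) :
    ProjSpace p s →ₗ[ℂ] V :=
  Finsupp.linearCombination ℂ fun x : ProjBasis p s =>
    match x with
    | .t n => T n
    | .b n => B n
    | .l k => L k
    | .r k => R k

section

variable {V : Type*} [AddCommGroup V] [Module ℂ V] (T B L R : ℕ → V) {n : ℕ}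

theorem mkHom_t (h : n < s) : mkHom p s T B L R (tv p s n) = T n := by
  simp [tv_of_lt h, mkHom]
theorem mkHom_b (h : n < s) : mkHom p s T B L R (bv p s n) = B n := by
  simp [bv_of_lt h, mkHom]
theorem mkHom_l (h : n < p - s) : mkHom p s T B L R (lv p s n) = L n := by
  simp [lv_of_lt h, mkHom]
theorem mkHom_r (h : n < p - s) : mkHom p s T B L R (rv p s n) = R n := by
  simp [rv_of_lt h, mkHom]

end

theorem sigmaBlock_eq (α β : ℂ) : sigmaBlock p s α β =
    mkHom p s 0 (fun n => α • tv p s n + β • bv p s n) 0 0 := by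
  refine Finsupp.lhom_ext' fun x => LinearMap.ext_ring ?_
  rcases x with ⟨n, hn⟩ | ⟨n, hn⟩ | ⟨n, hn⟩ | ⟨n, hn⟩ <;>
    simp [sigmaBlock, mkHom, tv, bv]

/-- The nilpotent endomorphism `t_n ↦ b_n` of the module `P^±_s`. -/
def topToBot (p s : ℕ) : Module.End ℂ (ProjSpace p s) := mkHom p s (bv p s) 0 0 0

/-- The module map `P^ε_s → P^{-ε}_{s'}`, `s + s' = p`, with `t_n ↦ l_n` and `r_k ↦ b_k`. -/
def toLeft (p s s' : ℕ) : ProjSpace p s →ₗ[ℂ] ProjSpace p s' := mkHom p s (lv p s') 0 0 (bv p s')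

/-- The module map `P^ε_s → P^{-ε}_{s'}`, `s + s' = p`, with `t_n ↦ r_n` and `l_k ↦ b_k`. -/
def toRight (p s s' : ℕ) : ProjSpace p s →ₗ[ℂ] ProjSpace p s' := mkHom p s (rv p s') 0 (bv p s') 0

/-- The rank-one operator that sends the basis vector `x` to `v` and the others to `0`. -/
def matUnit (x : ProjBasis p s) (v : ProjSpace p s) : Module.End ℂ (ProjSpace p s) :=
  (Finsupp.lapply x).smulRight v

theorem trace_mul_matUnit (A : Module.End ℂ (ProjSpace p s)) (x : ProjBasis p s)
    (v : ProjSpace p s) : LinearMap.trace ℂ _ (A * matUnit x v) = A v x := by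
  have : A * matUnit x v = (Finsupp.lapply x : ProjSpace p s →ₗ[ℂ] ℂ).smulRight (A v) := by
    ext; simp [matUnit]
  rw [this, LinearMap.trace_smulRight]
  rfl

section Intertwiners

variable {s' : ℕ} {ε ε' : ℤˣ} {h1 : 1 ≤ s} {h2 : s ≤ p - 1} {h1' : 1 ≤ s'} {h2' : s' ≤ p - 1}

theorem opKinv_comp {φ : ProjSpace p s →ₗ[ℂ] ProjSpace p s'}
    (h : φ ∘ₗ opK p s ε = opK p s' ε' ∘ₗ φ) : φ ∘ₗ opKinv p s ε = opKinv p s' ε' ∘ₗ φ := by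
  have e1 : opK p s ε ∘ₗ opKinv p s ε = LinearMap.id := opK_mul_opKinv ε
  have e2 : opKinv p s' ε' ∘ₗ opK p s' ε' = LinearMap.id := opKinv_mul_opK ε'
  calc φ ∘ₗ opKinv p s ε
      = (opKinv p s' ε' ∘ₗ opK p s' ε') ∘ₗ φ ∘ₗ opKinv p s ε := by rw [e2, LinearMap.id_comp]
    _ = opKinv p s' ε' ∘ₗ φ ∘ₗ (opK p s ε ∘ₗ opKinv p s ε) := by
      rw [LinearMap.comp_assoc, ← LinearMap.comp_assoc (opKinv p s ε) φ, ← h, LinearMap.comp_assoc]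
    _ = opKinv p s' ε' ∘ₗ φ := by rw [e1, LinearMap.comp_id]

/-- A linear map that commutes with `E`, `F` and `K` is a map of modules. -/
theorem comp_projRep {φ : ProjSpace p s →ₗ[ℂ] ProjSpace p s'}
    (hE : φ ∘ₗ opE p s ε = opE p s' ε' ∘ₗ φ) (hF : φ ∘ₗ opF p s = opF p s' ∘ₗ φ)
    (hK : φ ∘ₗ opK p s ε = opK p s' ε' ∘ₗ φ) (x : RestrictedUqSL2 p) :
    φ ∘ₗ projRep p ε s h1 h2 x = projRep p ε' s' h1' h2' x ∘ₗ φ := by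
  induction x using induct with
  | hc c => 
    rw [Algebra.algebraMap_eq_smul_one, map_smul, map_smul, map_one, map_one, LinearMap.comp_smul,
      LinearMap.smul_comp,
      Module.End.one_eq_id, Module.End.one_eq_id, LinearMap.comp_id, LinearMap.id_comp]
  | hE => simpa [projRep] using hE
  | hF => simpa [projRep] using hF
  | hK => simpa [projRep] using hK
  | hK' => simpa [projRep] using opKinv_comp hK
  | hmul a b ha hb =>
    rw [map_mul, map_mul, Module.End.mul_eq_comp, Module.End.mul_eq_comp, ← LinearMap.comp_assoc,
      ha, LinearMap.comp_assoc, hb, LinearMap.comp_assoc]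
  | hadd a b ha hb => rw [map_add, map_add, LinearMap.comp_add, ha, hb, LinearMap.add_comp]

end Intertwiners

end Blocks

/-! ### Module maps between the projective modules -/

section Blocks

variable {p s : ℕ}

section MatUnit

variable {m n : ℕ} (v : ProjSpace p s)

theorem matUnit_b_t (hm : m < s) : matUnit (.b ⟨m, hm⟩) v (tv p s n) = 0 := by
  by_cases h : n < s <;> simp [matUnit, tv, h]
theorem matUnit_b_b (hm : m < s) :
    matUnit (.b ⟨m, hm⟩) v (bv p s n) = if n = m then v else 0 := by
  by_cases h : n < s
  · by_cases e : n = m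
    · subst e; simp [matUnit, bv, h]
    · simp [matUnit, bv, h, e]
  · simp [bv, h, show n ≠ m by omega]
theorem matUnit_b_l (hm : m < s) : matUnit (.b ⟨m, hm⟩) v (lv p s n) = 0 := by
  by_cases h : n < p - s <;> simp [matUnit, lv, h]
theorem matUnit_b_r (hm : m < s) : matUnit (.b ⟨m, hm⟩) v (rv p s n) = 0 := by
  by_cases h : n < p - s <;> simp [matUnit, rv, h]
theorem matUnit_l_t (hm : m < p - s) : matUnit (.l ⟨m, hm⟩) v (tv p s n) = 0 := by
  by_cases h : n < s <;> simp [matUnit, tv, h]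
theorem matUnit_l_b (hm : m < p - s) : matUnit (.l ⟨m, hm⟩) v (bv p s n) = 0 := by
  by_cases h : n < s <;> simp [matUnit, bv, h]
theorem matUnit_l_l (hm : m < p - s) :
    matUnit (.l ⟨m, hm⟩) v (lv p s n) = if n = m then v else 0 := by
  by_cases h : n < p - s
  · by_cases e : n = m
    · subst e; simp [matUnit, lv, h]
    · simp [matUnit, lv, h, e]
  · simp [lv, h, show n ≠ m by omega]
theorem matUnit_l_r (hm : m < p - s) : matUnit (.l ⟨m, hm⟩) v (rv p s n) = 0 := by
  by_cases h : n < p - s <;> simp [matUnit, rv, h]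
theorem matUnit_r_t (hm : m < p - s) : matUnit (.r ⟨m, hm⟩) v (tv p s n) = 0 := by
  by_cases h : n < s <;> simp [matUnit, tv, h]
theorem matUnit_r_b (hm : m < p - s) : matUnit (.r ⟨m, hm⟩) v (bv p s n) = 0 := by
  by_cases h : n < s <;> simp [matUnit, bv, h]
theorem matUnit_r_l (hm : m < p - s) : matUnit (.r ⟨m, hm⟩) v (lv p s n) = 0 := by
  by_cases h : n < p - s <;> simp [matUnit, lv, h]
theorem matUnit_r_r (hm : m < p - s) :
    matUnit (.r ⟨m, hm⟩) v (rv p s n) = if n = m then v else 0 := by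
  by_cases h : n < p - s
  · by_cases e : n = m
    · subst e; simp [matUnit, rv, h]
    · simp [matUnit, rv, h, e]
  · simp [rv, h, show n ≠ m by omega]

end MatUnit

theorem tv_of_le {n : ℕ} (h : s ≤ n) : tv p s n = 0 := dif_neg (by omega)
theorem lv_of_le {n : ℕ} (h : p - s ≤ n) : lv p s n = 0 := dif_neg (by omega)

section

variable {n : ℕ} (s' : ℕ)

theorem topToBot_t (n : ℕ) : topToBot p s (tv p s n) = bv p s n := by
  by_cases h : n < s
  · exact mkHom_t _ _ _ _ h
  · rw [tv_of_le (by omega), bv_of_le (by omega), map_zero]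
theorem topToBot_b (n : ℕ) : topToBot p s (bv p s n) = 0 := by
  by_cases h : n < s
  · exact mkHom_b _ _ _ _ h
  · rw [bv_of_le (by omega), map_zero]
theorem topToBot_l (n : ℕ) : topToBot p s (lv p s n) = 0 := by
  by_cases h : n < p - s
  · exact mkHom_l _ _ _ _ h
  · rw [lv_of_le (by omega), map_zero]
theorem topToBot_r (n : ℕ) : topToBot p s (rv p s n) = 0 := by
  by_cases h : n < p - s
  · exact mkHom_r _ _ _ _ h
  · rw [rv_of_le (by omega), map_zero]

theorem toLeft_l (n : ℕ) : toLeft p s s' (lv p s n) = 0 := by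
  by_cases h : n < p - s
  · exact mkHom_l _ _ _ _ h
  · rw [lv_of_le (by omega), map_zero]
theorem toRight_r (n : ℕ) : toRight p s s' (rv p s n) = 0 := by
  by_cases h : n < p - s
  · exact mkHom_r _ _ _ _ h
  · rw [rv_of_le (by omega), map_zero]

variable {s'} (hp : s + s' = p)
include hp

theorem toLeft_t (n : ℕ) : toLeft p s s' (tv p s n) = lv p s' n := by
  by_cases h : n < s
  · exact mkHom_t _ _ _ _ h
  · rw [tv_of_le (by omega), lv_of_le (by omega), map_zero]
theorem toLeft_b (n : ℕ) : toLeft p s s' (bv p s n) = 0 := by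
  by_cases h : n < s
  · exact mkHom_b _ _ _ _ h
  · rw [bv_of_le (by omega), map_zero]
theorem toLeft_r (n : ℕ) : toLeft p s s' (rv p s n) = bv p s' n := by
  by_cases h : n < p - s
  · exact mkHom_r _ _ _ _ h
  · rw [rv_of_le (by omega), bv_of_le (by omega), map_zero]

theorem toRight_t (n : ℕ) : toRight p s s' (tv p s n) = rv p s' n := by
  by_cases h : n < s
  · exact mkHom_t _ _ _ _ h
  · rw [tv_of_le (by omega), rv_of_le (by omega), map_zero]
theorem toRight_b (n : ℕ) : toRight p s s' (bv p s n) = 0 := by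
  by_cases h : n < s
  · exact mkHom_b _ _ _ _ h
  · rw [bv_of_le (by omega), map_zero]
theorem toRight_l (n : ℕ) : toRight p s s' (lv p s n) = bv p s' n := by
  by_cases h : n < p - s
  · exact mkHom_l _ _ _ _ h
  · rw [lv_of_le (by omega), bv_of_le (by omega), map_zero]

end

variable {s' : ℕ} (ε : ℤˣ)

theorem topToBot_opK : topToBot p s ∘ₗ opK p s ε = opK p s ε ∘ₗ topToBot p s := by
  apply hom_ext_proj <;> intro n hn <;>
    simp [opK_t, opK_b, opK_l, opK_r, topToBot_t, topToBot_b, topToBot_l, topToBot_r]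

theorem topToBot_opE : topToBot p s ∘ₗ opE p s ε = opE p s ε ∘ₗ topToBot p s := by
  apply hom_ext_proj <;> intro n hn <;> simp only [LinearMap.comp_apply] <;> rcases n with _ | n <;>
    simp [opE_t_zero, opE_t_succ, opE_b_zero, opE_b_succ, opE_l_zero, opE_l_succ, opE_r_zero,
      opE_r_succ, topToBot_t, topToBot_b, topToBot_l, topToBot_r, hn]

theorem topToBot_opF : topToBot p s ∘ₗ opF p s = opF p s ∘ₗ topToBot p s := by
  apply hom_ext_proj <;> intro n hn <;> simp only [LinearMap.comp_apply]
  · rw [topToBot_t, opF_b]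
    by_cases h : n + 1 < s
    · rw [opF_t h, topToBot_t]
    · obtain rfl : n = s - 1 := by omega
      rw [opF_t_last (by omega), topToBot_r, bv_of_le (by omega)]
  · rw [opF_b, topToBot_b, topToBot_b, map_zero]
  · rw [topToBot_l, map_zero]
    by_cases h : n + 1 < p - s
    · rw [opF_l h, topToBot_l]
    · obtain rfl : n = p - s - 1 := by omega
      rw [opF_l_last (by omega), topToBot_b]
  · rw [opF_r, topToBot_r, topToBot_r, map_zero]

variable (hp : s + s' = p)
include hp

theorem toLeft_opK : toLeft p s s' ∘ₗ opK p s ε = opK p s' (-ε) ∘ₗ toLeft p s s' := by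
  have e1 : (p : ℤ) = s + s' := by exact_mod_cast hp.symm
  apply hom_ext_proj <;> intro n hn <;>
    simp [opK_t, opK_b, opK_l, opK_r, toLeft_t hp, toLeft_b hp, toLeft_l, toLeft_r hp, e1]

theorem toLeft_opE : toLeft p s s' ∘ₗ opE p s ε = opE p s' (-ε) ∘ₗ toLeft p s s' := by
  have e1 : (p : ℤ) = s + s' := by exact_mod_cast hp.symm
  have e2 : p - s = s' := by omega
  have e3 : p - s' = s := by omega
  apply hom_ext_proj <;> intro n hn <;> simp only [LinearMap.comp_apply] <;> rcases n with _ | n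
  · rw [opE_t_zero ε hn, toLeft_l, toLeft_t hp, opE_l_zero]
  · rw [opE_t_succ ε hn, map_add, map_smul, toLeft_t hp, toLeft_t hp, toLeft_b hp,
      opE_l_succ _ (by omega)]
    simp [e1]
  · rw [opE_b_zero, toLeft_b hp, map_zero, map_zero]
  · rw [opE_b_succ ε hn, map_smul, toLeft_b hp, toLeft_b hp, map_zero, smul_zero]
  · rw [opE_l_zero, toLeft_l, map_zero, map_zero]
  · rw [opE_l_succ ε hn, map_smul, toLeft_l, toLeft_l, map_zero, smul_zero]
  · rw [opE_r_zero ε hn, toLeft_r hp, toLeft_b hp, opE_b_zero]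
  · rw [opE_r_succ ε hn, map_smul, toLeft_r hp, toLeft_r hp, opE_b_succ _ (by omega)]
    simp [e1]

theorem toLeft_opF : toLeft p s s' ∘ₗ opF p s = opF p s' ∘ₗ toLeft p s s' := by
  have e3 : p - s' = s := by omega
  apply hom_ext_proj <;> intro n hn <;> simp only [LinearMap.comp_apply]
  · rw [toLeft_t hp]
    by_cases h : n + 1 < s
    · rw [opF_t h, opF_l (by omega), toLeft_t hp]
    · obtain rfl : n = s - 1 := by omega
      have h' := opF_l_last (p := p) (s := s') (by omega)
      rw [e3] at h'
      rw [opF_t_last (by omega), toLeft_r hp, h']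
  · rw [opF_b, toLeft_b hp, toLeft_b hp, map_zero]
  · rw [toLeft_l, map_zero]
    by_cases h : n + 1 < p - s
    · rw [opF_l h, toLeft_l]
    · obtain rfl : n = p - s - 1 := by omega
      rw [opF_l_last (by omega), toLeft_b hp]
  · rw [opF_r, toLeft_r hp, toLeft_r hp, opF_b]

theorem toRight_opK : toRight p s s' ∘ₗ opK p s ε = opK p s' (-ε) ∘ₗ toRight p s s' := by
  have e1 : (p : ℤ) = s + s' := by exact_mod_cast hp.symm
  apply hom_ext_proj <;> intro n hn <;>
    simp [opK_t, opK_b, opK_l, opK_r, toRight_t hp, toRight_b hp, toRight_l hp, toRight_r, e1]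

theorem toRight_opE : toRight p s s' ∘ₗ opE p s ε = opE p s' (-ε) ∘ₗ toRight p s s' := by
  have e1 : (p : ℤ) = s + s' := by exact_mod_cast hp.symm
  have e2 : p - s = s' := by omega
  have e3 : p - s' = s := by omega
  apply hom_ext_proj <;> intro n hn <;> simp only [LinearMap.comp_apply] <;> rcases n with _ | n
  · rw [opE_t_zero ε hn, toRight_l hp, toRight_t hp, opE_r_zero _ (by omega), e2]
  · rw [opE_t_succ ε hn, map_add, map_smul, toRight_t hp, toRight_t hp, toRight_b hp,
      opE_r_succ _ (by omega)]
    simp [e1]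
  · rw [opE_b_zero, toRight_b hp, map_zero, map_zero]
  · rw [opE_b_succ ε hn, map_smul, toRight_b hp, toRight_b hp, map_zero, smul_zero]
  · rw [opE_l_zero, toRight_l hp, map_zero, opE_b_zero]
  · rw [opE_l_succ ε hn, map_smul, toRight_l hp, toRight_l hp, opE_b_succ _ (by omega)]
    simp [e1]
  · rw [opE_r_zero ε hn, toRight_r, toRight_b hp, map_zero]
  · rw [opE_r_succ ε hn, map_smul, toRight_r, toRight_r, map_zero, smul_zero]

theorem toRight_opF : toRight p s s' ∘ₗ opF p s = opF p s' ∘ₗ toRight p s s' := by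
  apply hom_ext_proj <;> intro n hn <;> simp only [LinearMap.comp_apply]
  · rw [toRight_t hp, opF_r]
    by_cases h : n + 1 < s
    · rw [opF_t h, toRight_t hp]
    · obtain rfl : n = s - 1 := by omega
      rw [opF_t_last (by omega), toRight_r, rv_of_le (by omega)]
  · rw [opF_b, toRight_b hp, toRight_b hp, map_zero]
  · rw [toRight_l hp, opF_b]
    by_cases h : n + 1 < p - s
    · rw [opF_l h, toRight_l hp]
    · obtain rfl : n = p - s - 1 := by omega
      rw [opF_l_last (by omega), toRight_b hp, bv_of_le (by omega)]
  · rw [opF_r, toRight_r, toRight_r, map_zero]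

end Blocks

/-! ### Commutators with a block of `σ` -/

section Blocks

variable {p s : ℕ} (ε : ℤˣ) (α β : ℂ)

theorem opK_comm_sigmaBlock :
    opK p s ε * sigmaBlock p s α β = sigmaBlock p s α β * opK p s ε := by
  rw [sigmaBlock_eq]
  apply end_ext <;> intro n hn <;> simp only [Module.End.mul_apply]
  · rw [mkHom_t _ _ _ _ hn, opK_t, map_smul, mkHom_t _ _ _ _ hn]; simp
  · rw [mkHom_b _ _ _ _ hn, opK_b, map_smul, mkHom_b _ _ _ _ hn, map_add, map_smul, map_smul,
      opK_t, opK_b]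
    module
  · rw [mkHom_l _ _ _ _ hn, opK_l, map_smul, mkHom_l _ _ _ _ hn]; simp
  · rw [mkHom_r _ _ _ _ hn, opK_r, map_smul, mkHom_r _ _ _ _ hn]; simp

/-- The commutator of `E` with `σ` is a commutator with the module map `t_n ↦ b_n`, up to the two
rank-one operators `b_0 ↦ l_{p-s-1}` and `r_0 ↦ t_{s-1}`. -/
theorem commutator_opE_sigmaBlock (h1 : 0 < s) (h2 : 0 < p - s) :
    ∃ τ : Module.End ℂ (ProjSpace p s),
      opE p s ε * sigmaBlock p s α β - sigmaBlock p s α β * opE p s ε =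
        (topToBot p s * τ - τ * topToBot p s) +
          α • (matUnit (.b ⟨0, h1⟩) (lv p s (p - s - 1)) -
            matUnit (.r ⟨0, h2⟩) (tv p s (s - 1))) := by
  -- The values on `t` and `r` account for the `β`-terms `t_n ↦ -β b_{n-1}`, `r_0 ↦ -β b_{s-1}` of the
  -- commutator, those on `b` for its terms `b_n ↦ α b_{n-1}` and `t_n ↦ -α t_{n-1}`, `n ≥ 1`.
  refine ⟨mkHom p s (fun n => if n = 0 then 0 else -β • tv p s (n - 1))
    (fun n => if n = 0 then 0 else α • tv p s (n - 1)) 0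
    (fun k => if k = 0 then -β • tv p s (s - 1) else 0), ?_⟩
  rw [sigmaBlock_eq]
  apply end_ext <;> intro n hn <;>
    simp only [Module.End.mul_apply, LinearMap.sub_apply, LinearMap.add_apply,
      LinearMap.smul_apply, matUnit_b_t, matUnit_b_b, matUnit_b_l, matUnit_b_r, matUnit_r_t,
      matUnit_r_b, matUnit_r_l, matUnit_r_r, topToBot_t, topToBot_b, topToBot_l, topToBot_r,
      mkHom_t, mkHom_b, mkHom_l, mkHom_r, hn] <;>
    rcases n with _ | n
  · rw [opE_t_zero ε hn, mkHom_l _ _ _ _ (by omega)]; simp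
  · rw [opE_t_succ ε hn, map_add, map_smul, mkHom_t _ _ _ _ (by omega),
      mkHom_b _ _ _ _ (by omega)]
    simp [topToBot_t]
    abel
  · rw [map_add, map_smul, map_smul, opE_t_zero ε hn, opE_b_zero]; simp
  · rw [map_add, map_smul, map_smul, opE_t_succ ε hn, opE_b_succ ε hn, map_smul,
      mkHom_b _ _ _ _ (by omega)]
    simp [topToBot_t]
    module
  · rw [opE_l_zero]; simp
  · rw [opE_l_succ ε hn, map_smul, mkHom_l _ _ _ _ (by omega)]; simp
  · rw [opE_r_zero ε hn, mkHom_b _ _ _ _ (by omega)]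
    simp [topToBot_t]
  · rw [opE_r_succ ε hn, map_smul, mkHom_r _ _ _ _ (by omega)]; simp

/-- The commutator of `F` with `σ` is a commutator with the module map `t_n ↦ b_n`, up to the two
rank-one operators `b_{s-1} ↦ r_0` and `l_{p-s-1} ↦ t_0`. -/
theorem commutator_opF_sigmaBlock (h1 : s - 1 < s) (h2 : p - s - 1 < p - s) :
    ∃ τ : Module.End ℂ (ProjSpace p s),
      opF p s * sigmaBlock p s α β - sigmaBlock p s α β * opF p s =
        (topToBot p s * τ - τ * topToBot p s) +
          α • (matUnit (.b ⟨s - 1, h1⟩) (rv p s 0) -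
            matUnit (.l ⟨p - s - 1, h2⟩) (tv p s 0)) := by
  -- The commutator sends `l_{p-s-1}` to `-α t_0 - β b_0`; this operator accounts for `-β b_0`.
  refine ⟨mkHom p s 0 0 (fun k => if k = p - s - 1 then -β • tv p s 0 else 0) 0, ?_⟩
  rw [sigmaBlock_eq]
  apply end_ext <;> intro n hn <;>
    simp only [Module.End.mul_apply, LinearMap.sub_apply, LinearMap.add_apply,
      LinearMap.smul_apply, matUnit_b_t, matUnit_b_b, matUnit_b_l, matUnit_b_r, matUnit_l_t,
      matUnit_l_b, matUnit_l_l, matUnit_l_r, topToBot_t, topToBot_b, topToBot_l, topToBot_r,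
      mkHom_t, mkHom_b, mkHom_l, mkHom_r, hn]
  · by_cases h : n + 1 < s
    · rw [opF_t h, mkHom_t _ _ _ _ h]; simp
    · obtain rfl : n = s - 1 := by omega
      rw [opF_t_last (by omega), mkHom_r _ _ _ _ (by omega)]; simp
  · by_cases h : n + 1 < s
    · rw [map_add, map_smul, map_smul, opF_t h, opF_b, mkHom_b _ _ _ _ h]
      simp [show n ≠ s - 1 by omega]
    · obtain rfl : n = s - 1 := by omega
      rw [map_add, map_smul, map_smul, opF_t_last (by omega), opF_b, bv_of_le (by omega)]; simp
  · by_cases h : n + 1 < p - s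
    · rw [opF_l h, mkHom_l _ _ _ _ h]; simp [show n ≠ p - s - 1 by omega]
    · obtain rfl : n = p - s - 1 := by omega
      rw [opF_l_last (by omega), mkHom_b _ _ _ _ (by omega)]
      simp [topToBot_t]
  · rw [opF_r]
    by_cases h : n + 1 < p - s
    · rw [mkHom_r _ _ _ _ h]; simp
    · rw [rv_of_le (by omega)]; simp

theorem projRep_E (h1 : 1 ≤ s) (h2 : s ≤ p - 1) : projRep p ε s h1 h2 (E p) = opE p s ε := lift_E _
theorem projRep_F (h1 : 1 ≤ s) (h2 : s ≤ p - 1) : projRep p ε s h1 h2 (F p) = opF p s := lift_F _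
theorem projRep_K (h1 : 1 ≤ s) (h2 : s ≤ p - 1) : projRep p ε s h1 h2 (K p) = opK p s ε := lift_K _

variable {α β} (h1 : 1 ≤ s) (h2 : s ≤ p - 1) (x : RestrictedUqSL2 p)

/-- The trace of the action against an operator `c` does not see commutators of `τ` with the module
map `t_n ↦ b_n`, by cyclicity; a rank-one summand of `c` contributes a matrix coefficient. -/
theorem trace_mul_eq_of_commutator {c : Module.End ℂ (ProjSpace p s)} {i j : ProjBasis p s}
    {v w : ProjSpace p s}
    (h : ∃ τ, c = (topToBot p s * τ - τ * topToBot p s) + α • (matUnit i v - matUnit j w)) :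
    LinearMap.trace ℂ _ (projRep p ε s h1 h2 x * c) =
      α * (projRep p ε s h1 h2 x v i - projRep p ε s h1 h2 x w j) := by
  obtain ⟨τ, rfl⟩ := h
  have hj : topToBot p s * projRep p ε s h1 h2 x = projRep p ε s h1 h2 x * topToBot p s :=
    comp_projRep (topToBot_opE ε) topToBot_opF (topToBot_opK ε) x
  rw [mul_add, map_add, trace_mul_commutator, hj, sub_self, zero_add, mul_smul_comm, map_smul,
    mul_sub (projRep p ε s h1 h2 x), map_sub, trace_mul_matUnit, trace_mul_matUnit, smul_eq_mul]

section Transfer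

variable {s' : ℕ} (hp : s + s' = p)
include hp

theorem toLeft_apply_b (v : ProjSpace p s) {k : ℕ} (hk' : k < s') (hk : k < p - s) :
    toLeft p s s' v (.b ⟨k, hk'⟩) = v (.r ⟨k, hk⟩) := by
  have : (Finsupp.lapply (.b ⟨k, hk'⟩) : ProjSpace p s' →ₗ[ℂ] ℂ) ∘ₗ toLeft p s s' =
      Finsupp.lapply (.r ⟨k, hk⟩) := by
    apply hom_ext_proj <;> intro n hn <;> simp only [LinearMap.comp_apply]
    · rw [toLeft_t hp, lv_of_lt (by omega), tv_of_lt hn]; simp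
    · rw [toLeft_b hp, bv_of_lt hn]; simp
    · rw [toLeft_l, lv_of_lt hn]; simp
    · rw [toLeft_r hp, bv_of_lt (by omega), rv_of_lt hn]
      by_cases e : n = k
      · subst e; simp
      · simp [e]
  exact LinearMap.congr_fun this v

theorem toRight_apply_b (v : ProjSpace p s) {k : ℕ} (hk' : k < s') (hk : k < p - s) :
    toRight p s s' v (.b ⟨k, hk'⟩) = v (.l ⟨k, hk⟩) := by
  have : (Finsupp.lapply (.b ⟨k, hk'⟩) : ProjSpace p s' →ₗ[ℂ] ℂ) ∘ₗ toRight p s s' =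
      Finsupp.lapply (.l ⟨k, hk⟩) := by
    apply hom_ext_proj <;> intro n hn <;> simp only [LinearMap.comp_apply]
    · rw [toRight_t hp, rv_of_lt (by omega), tv_of_lt hn]; simp
    · rw [toRight_b hp, bv_of_lt hn]; simp
    · rw [toRight_l hp, bv_of_lt (by omega), lv_of_lt hn]
      by_cases e : n = k
      · subst e; simp
      · simp [e]
    · rw [toRight_r, rv_of_lt hn]; simp
  exact LinearMap.congr_fun this v

variable {ε' : ℤˣ} (hε : ε' = -ε) (h1' : 1 ≤ s') (h2' : s' ≤ p - 1)
include hε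

/-- The matrix coefficient of `P^ε_s` from `t_n` to `r_k` is the one of `P^{-ε}_{p-s}` from `l_n`
to `b_k`. -/
theorem coeff_t_r_eq_coeff_l_b (n : ℕ) {k : ℕ} (hk' : k < s') (hk : k < p - s) :
    projRep p ε s h1 h2 x (tv p s n) (.r ⟨k, hk⟩) =
      projRep p ε' s' h1' h2' x (lv p s' n) (.b ⟨k, hk'⟩) := by
  subst hε
  rw [← toLeft_apply_b hp _ hk', ← toLeft_t hp]
  have h := LinearMap.congr_fun (comp_projRep (h1 := h1) (h2 := h2) (h1' := h1') (h2' := h2')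
    (toLeft_opE ε hp) (toLeft_opF hp) (toLeft_opK ε hp) x) (tv p s n)
  rw [LinearMap.comp_apply, LinearMap.comp_apply] at h
  rw [h]

/-- The matrix coefficient of `P^ε_s` from `t_n` to `l_k` is the one of `P^{-ε}_{p-s}` from `r_n`
to `b_k`. -/
theorem coeff_t_l_eq_coeff_r_b (n : ℕ) {k : ℕ} (hk' : k < s') (hk : k < p - s) :
    projRep p ε s h1 h2 x (tv p s n) (.l ⟨k, hk⟩) =
      projRep p ε' s' h1' h2' x (rv p s' n) (.b ⟨k, hk'⟩) := by
  subst hε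
  rw [← toRight_apply_b hp _ hk', ← toRight_t hp]
  have h := LinearMap.congr_fun (comp_projRep (h1 := h1) (h2 := h2) (h1' := h1') (h2' := h2')
    (toRight_opE ε hp) (toRight_opF hp) (toRight_opK ε hp) x) (tv p s n)
  rw [LinearMap.comp_apply, LinearMap.comp_apply] at h
  rw [h]

end Transfer

end Blocks

/-! ### Traces over `P^+_s ⊕ P^-_{p-s}` -/

section Sum

variable {p s : ℕ} (h1 : 1 ≤ s) (h2 : s ≤ p - 1) (αp αm βp βm : ℂ)

/-- The pairing of `x` with the commutator of `y` and `σ_s` splits over the two blocks. -/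
theorem trace_sumRep_commutator (x y : RestrictedUqSL2 p) :
    LinearMap.trace ℂ _ (sumRep p s h1 h2 x *
      (sumRep p s h1 h2 y * sigma p s αp αm βp βm -
        sigma p s αp αm βp βm * sumRep p s h1 h2 y)) =
    LinearMap.trace ℂ _ (projRep p 1 s h1 h2 x *
      (projRep p 1 s h1 h2 y * sigmaBlock p s αp βp -
        sigmaBlock p s αp βp * projRep p 1 s h1 h2 y)) +
    LinearMap.trace ℂ _ (projRep p (-1) (p - s) (by omega) (by omega) x *
      (projRep p (-1) (p - s) (by omega) (by omega) y * sigmaBlock p (p - s) αm βm -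
        sigmaBlock p (p - s) αm βm * projRep p (-1) (p - s) (by omega) (by omega) y)) := by
  rw [← LinearMap.trace_prodMap']
  rfl

/-- By the isomorphism of the subquotients spanned by `t, r` in `P^ε_s` and by `l, b` in
`P^{-ε}_{p-s}`, the two blocks contribute opposite multiples of one difference of matrix
coefficients. -/
theorem trace_commutator_E (x : RestrictedUqSL2 p) :
    LinearMap.trace ℂ _ (sumRep p s h1 h2 x *
      (sumRep p s h1 h2 (E p) * sigma p s αp αm βp βm -
        sigma p s αp αm βp βm * sumRep p s h1 h2 (E p))) =
    (αp - αm) * (projRep p 1 s h1 h2 x (lv p s (p - s - 1)) (.b ⟨0, h1⟩) -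
      projRep p 1 s h1 h2 x (tv p s (s - 1)) (.r ⟨0, by omega⟩)) := by
  rw [trace_sumRep_commutator]
  rw [projRep_E, projRep_E, trace_mul_eq_of_commutator 1 h1 h2 x
      (commutator_opE_sigmaBlock 1 αp βp (by omega) (by omega)),
    trace_mul_eq_of_commutator (-1) (by omega) (by omega) x
      (commutator_opE_sigmaBlock (-1) αm βm (by omega) (by omega)),
    coeff_t_r_eq_coeff_l_b 1 h1 h2 x (s' := p - s) (by omega) rfl (by omega) (by omega) _
      (by omega),
    coeff_t_r_eq_coeff_l_b (-1) (by omega) (by omega) x (s' := s) (by omega) (neg_neg 1).symm h1 h2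
      _ (by omega), show p - (p - s) - 1 = s - 1 by omega]
  ring

/-- The analogue of `trace_commutator_E` for `F`, with the subquotients spanned by `t, l` in `P^ε_s`
and by `r, b` in `P^{-ε}_{p-s}`. -/
theorem trace_commutator_F (x : RestrictedUqSL2 p) :
    LinearMap.trace ℂ _ (sumRep p s h1 h2 x *
      (sumRep p s h1 h2 (F p) * sigma p s αp αm βp βm -
        sigma p s αp αm βp βm * sumRep p s h1 h2 (F p))) =
    (αp - αm) * (projRep p 1 s h1 h2 x (rv p s 0) (.b ⟨s - 1, by omega⟩) -
      projRep p 1 s h1 h2 x (tv p s 0) (.l ⟨p - s - 1, by omega⟩)) := by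
  rw [trace_sumRep_commutator]
  rw [projRep_F, projRep_F, trace_mul_eq_of_commutator 1 h1 h2 x
      (commutator_opF_sigmaBlock αp βp (by omega) (by omega)),
    trace_mul_eq_of_commutator (-1) (by omega) (by omega) x
      (commutator_opF_sigmaBlock αm βm (by omega) (by omega)),
    coeff_t_l_eq_coeff_r_b 1 h1 h2 x (s' := p - s) (by omega) rfl (by omega) (by omega) _
      (by omega),
    coeff_t_l_eq_coeff_r_b (-1) (by omega) (by omega) x (s' := s) (by omega) (neg_neg 1).symm h1 h2
      _ (by omega)]
  have e : (⟨p - (p - s) - 1, by omega⟩ : Fin s) = ⟨s - 1, by omega⟩ := by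
    ext; simp only; omega
  rw [e]
  ring

theorem sumRep_K_mul_sigma : sumRep p s h1 h2 (K p) * sigma p s αp αm βp βm =
    sigma p s αp αm βp βm * sumRep p s h1 h2 (K p) := by
  have e : sumRep p s h1 h2 (K p) = LinearMap.prodMap (opK p s 1) (opK p (p - s) (-1)) := by
    rw [← projRep_K 1 h1 h2, ← projRep_K (-1) (by omega) (by omega)]
    rfl
  rw [e]
  change LinearMap.prodMap (opK p s 1 * sigmaBlock p s αp βp)
    (opK p (p - s) (-1) * sigmaBlock p (p - s) αm βm) = _
  rw [opK_comm_sigmaBlock, opK_comm_sigmaBlock]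
  rfl

/-- The operators `b` with `Tr (x [b, c]) = 0` for all `x` in the image of an algebra `A` are closed
under products, since `[b b', c] = b [b', c] + [b, c] b'`. -/
theorem trace_commutator_mul {A V : Type*} [Ring A] [Algebra ℂ A] [AddCommGroup V] [Module ℂ V]
    (ρ : A →ₐ[ℂ] Module.End ℂ V) (c : Module.End ℂ V) {a b : A}
    (ha : ∀ x, LinearMap.trace ℂ V (ρ x * (ρ a * c - c * ρ a)) = 0)
    (hb : ∀ x, LinearMap.trace ℂ V (ρ x * (ρ b * c - c * ρ b)) = 0) (x : A) :
    LinearMap.trace ℂ V (ρ x * (ρ (a * b) * c - c * ρ (a * b))) = 0 := by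
  have e : ρ x * (ρ (a * b) * c - c * ρ (a * b)) =
      ρ (x * a) * (ρ b * c - c * ρ b) + ρ x * (ρ a * c - c * ρ a) * ρ b := by
    simp only [map_mul]
    noncomm_ring
  rw [e, map_add, hb, zero_add, LinearMap.trace_mul_comm, ← mul_assoc, ← map_mul, ha]

/-- An operator `c` that commutes with `K`, and with `E` and `F` up to operators that are
trace-orthogonal to the image of the algebra, commutes up to such operators with the whole image. -/
theorem trace_commutator_eq_zero {p : ℕ} {V : Type*} [AddCommGroup V] [Module ℂ V]
    (ρ : RestrictedUqSL2 p →ₐ[ℂ] Module.End ℂ V) (c : Module.End ℂ V)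
    (hE : ∀ x, LinearMap.trace ℂ V (ρ x * (ρ (E p) * c - c * ρ (E p))) = 0)
    (hF : ∀ x, LinearMap.trace ℂ V (ρ x * (ρ (F p) * c - c * ρ (F p))) = 0)
    (hK : ρ (K p) * c = c * ρ (K p)) (y x : RestrictedUqSL2 p) :
    LinearMap.trace ℂ V (ρ x * (ρ y * c - c * ρ y)) = 0 := by
  have h := satisfies_gen p
  have hki : ρ (Kinv p) * c = c * ρ (Kinv p) := by
    have e1 : ρ (K p) * ρ (Kinv p) = 1 := by rw [← map_mul, h.k_ki, map_one]
    have e2 : ρ (Kinv p) * ρ (K p) = 1 := by rw [← map_mul, h.ki_k, map_one]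
    calc ρ (Kinv p) * c = ρ (Kinv p) * (c * ρ (K p)) * ρ (Kinv p) := by
          rw [mul_assoc, mul_assoc c, e1, mul_one]
      _ = c * ρ (Kinv p) := by rw [← hK, ← mul_assoc, e2, one_mul]
  induction y using induct generalizing x with
  | hc r => rw [AlgHom.commutes, Algebra.commutes r c, sub_self, mul_zero, map_zero]
  | hE => exact hE x
  | hF => exact hF x
  | hK => rw [hK, sub_self, mul_zero, map_zero]
  | hK' => rw [hki, sub_self, mul_zero, map_zero]
  | hmul a b ha hb => exact trace_commutator_mul _ _ ha hb x
  | hadd a b ha hb =>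
    rw [map_add, add_mul, mul_add, add_sub_add_comm, mul_add, map_add, ha, hb, add_zero]

/-- The element `F K` tells the two matrix coefficients of `trace_commutator_E` apart: they are
`q^(1+s)` and `q^(1-s)`. -/
theorem coeff_F_mul_K_ne_zero (hb : 0 < s) (hr : 0 < p - s) :
    projRep p 1 s h1 h2 (F p * K p) (lv p s (p - s - 1)) (.b ⟨0, hb⟩) -
      projRep p 1 s h1 h2 (F p * K p) (tv p s (s - 1)) (.r ⟨0, hr⟩) ≠ 0 := by
  have hq := q_ne_zero p
  have hp : 0 < p := by omega
  have hl : projRep p 1 s h1 h2 (F p * K p) (lv p s (p - s - 1)) (.b ⟨0, hb⟩) =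
      q p ^ (1 + s : ℤ) := by
    rw [map_mul, Module.End.mul_apply, projRep_F, projRep_K, opK_l, map_smul, opF_l_last hr,
      bv_of_lt hb, show (p : ℤ) - s - 1 - 2 * ((p - s - 1 : ℕ) : ℤ) = -(p : ℤ) + (1 + s) by
        push_cast [show s ≤ p by omega, show 1 ≤ p - s by omega]; ring,
      zpow_add₀ hq, zpow_neg, q_zpow_p hp]
    norm_num
  have ht : projRep p 1 s h1 h2 (F p * K p) (tv p s (s - 1)) (.r ⟨0, hr⟩) =
      q p ^ (1 - s : ℤ) := by
    rw [map_mul, Module.End.mul_apply, projRep_F, projRep_K, opK_t, map_smul, opF_t_last hb,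
      rv_of_lt hr, show (s : ℤ) - 1 - 2 * ((s - 1 : ℕ) : ℤ) = 1 - s by push_cast [h1]; ring]
    norm_num
  rw [hl, ht, sub_ne_zero]
  intro h
  refine (q_sq_primitive hp).pow_ne_one_of_pos_of_lt (l := s) (by omega) (by omega) ?_
  rw [show (1 + s : ℤ) = (1 - s) + ((2 * s : ℕ) : ℤ) by push_cast; ring, zpow_add₀ hq,
    zpow_natCast] at h
  rw [← pow_mul]
  exact mul_left_cancel₀ (zpow_ne_zero _ hq) (h.trans (mul_one _).symm)

end Sum

end UqSL2

end

/-- For `1 ≤ s ≤ p - 1` (so that `p ≥ 2`) and all coefficients `α^±`, `β^±` of `σ_s`, the functional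
`γ(s)` on the restricted quantum group is a q-character if and only if `α^+ = α^-`. -/
theorem mainTheorem7 (p : ℕ) [NeZero p] (s : ℕ) (hs : 1 ≤ s) (hsp : s ≤ p - 1)
    (αp αm βp βm : ℂ) :
    UqSL2.gammaFun p s hs hsp αp αm βp βm ∈ qCharacters ℂ (RestrictedUqSL2 p) ↔ αp = αm := by
  rw [UqSL2.gammaFun_mem_iff]
  constructor
  · intro h
    have hEF := h (UqSL2.E p) (UqSL2.F p * UqSL2.K p)
    rw [UqSL2.trace_commutator_E] at hEF
    exact sub_eq_zero.mp ((mul_eq_zero.mp hEF).resolve_right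
      (UqSL2.coeff_F_mul_K_ne_zero hs hsp _ _))
  · rintro rfl y x
    refine UqSL2.trace_commutator_eq_zero _ _ (fun x => ?_) (fun x => ?_)
      (UqSL2.sumRep_K_mul_sigma hs hsp αp αp βp βm) y x
    · rw [UqSL2.trace_commutator_E, sub_self, zero_mul]
    · rw [UqSL2.trace_commutator_F, sub_self, zero_mul]
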